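/- Let $k$ be a field and let $N\hookrightarrow M$ be an extension of $k$-algebras that is a symmetric Markov extension: there are an $N$-bimodule map $E:M\to N$, finite families $(x_i),(y_i)$ in $M$, a scalar $\lambda\in k\setminus\{0\}$ and a linear map $T:N\to k$ such that, for all $m,m'\in M$, $n,n'\in N$ and $u\in U:=C_M(N)$ (summation over repeated indices), $$E(mx_i)y_i=m=x_iE(y_im),\quad E(1)=1,\quad x_iy_i=\lambda^{-1}1,\quad T(nn')=T(n'n),\quad T(1)=1,\quad TE(mm')=TE(m'm),\quad E(um)=E(mu).$$ Let $M_1=\mathrm{End}(M_N)$ be the endomorphism algebra of the right $N$-module $M$, with $M\subseteq M_1$ by left multiplication, Jones idempotent $e_1=E\in M_1$ and conditional expectation $E_M:M_1\to M$, $E_M(me_1m')=\lambda mm'$. Then $M_1/M$ is again of this kind, with dual bases $\lambda^{-1}x_ie_1$, $e_1y_i$ and the same $\lambda$; let $M_2=\mathrm{End}((M_1)_M)$, $e_2$, $E_{M_1}:M_2\to M_1$ be the next step of the construction. Put $$A=C_{M_1}(N),\quad B=C_{M_2}(M),\quad V=C_{M_1}(M),\quad T_0=TE,\quad T_1=TEE_M,\quad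 T_2=TEE_ME_{M_1}.$$ Assume further: 1. $y_ix_i=\lambda^{-1}1$, or, alternatively, $T_1(x_iue_1y_i)=T_0(u)$ for all $u\in U$; 2. $U$ is Kanzaki separable (it has a symmetric separability element) and $T_0|_U$ is non-degenerate; 3. (depth 2) $E_M$ has dual bases in $A$, and $E_{M_1}$ has dual bases in $B$. Let $f=f^{(1)}\otimes f^{(2)}\in V\otimes V$ be the unique symmetric separability element of $V$ and $w=[f^{(1)}T_1(f^{(2)})]^{-1}\in V$. Put $\langle a,b\rangle=\lambda^{-2}T_2(ae_2e_1wb)$ for $a\in A$, $b\in B$, and let $S_B:B\to B$ be the linear automorphism given by $\langle a,b\rangle=\lambda^{-2}T_2(S_B(b)e_1e_2wa)$. Then the formulas $$\langle a_{(1)},b\rangle\langle a_{(2)},b'\rangle=\langle a,bb'\rangle,\qquad \varepsilon(a)=\langle a,1\rangle,\qquad \langle S(a),b\rangle=\langle a,S_B(b)\rangle\qquad(a\in A,\ b,b'\in B)$$ define a unique weak Hopf algebra structure $(\Delta,\varepsilon,S)$ on the algebra $A$. Its target counital subalgebra $A_t=\{a\in A:\varepsilon(1_{(1)}a)1_{(2)}=a\}$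 is $U$. The formula $a\triangleright m=a_{(1)}mS(a_{(2)})$ (a product in $M_1$) defines a map $A\otimes M\to M$ which makes $M$ a left $A$-module algebra, that is, an $A$-module with $a\triangleright(mm')=(a_{(1)}\triangleright m)(a_{(2)}\triangleright m')$ and $a\triangleright 1=\varepsilon_t(a)\triangleright 1$, where $\varepsilon_t(a)=\varepsilon(1_{(1)}a)1_{(2)}$; moreover $u\triangleright 1=u$ for $u\in U$. Let $M\# A$ be the smash product algebra: the vector space $M\otimes_{A_t}A=M\otimes_UA$ (where $m\cdot z=m(z\triangleright 1)$ for $z\in A_t$), with $m\# a$ the class of $m\otimes a$, multiplication $(m\# a)(m'\# a')=m(a_{(1)}\triangleright m')\# a_{(2)}a'$ and unit $1\# 1$. Then the mapping $$\phi:M\# A\to M_1,\qquad m\# a\mapsto ma,$$ is a well-defined isomorphism of $k$-algebras. -/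

import Mathlib

open scoped TensorProduct

section WeakHopf

/-- The target counital map `ε_t(h) = (ε ⊗ id)(Δ(1)(h ⊗ 1))`. -/
noncomputable def targetCounit (k H : Type*) [Field k] [Ring H] [Algebra k H]
    [CoalgebraStruct k H] : H →ₗ[k] H :=
  (TensorProduct.lid k H).toLinearMap ∘ₗ
    (CoalgebraStruct.counit (R := k) (A := H)).rTensor H ∘ₗ
      LinearMap.mulLeft k (CoalgebraStruct.comul (R := k) (1 : H)) ∘ₗ
        (TensorProduct.mk k H H).flip 1

/-- The source counital map `ε_s(h) = (id ⊗ ε)((1 ⊗ h)Δ(1))`. -/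
noncomputable def sourceCounit (k H : Type*) [Field k] [Ring H] [Algebra k H]
    [CoalgebraStruct k H] : H →ₗ[k] H :=
  (TensorProduct.rid k H).toLinearMap ∘ₗ
    (CoalgebraStruct.counit (R := k) (A := H)).lTensor H ∘ₗ
      LinearMap.mulRight k (CoalgebraStruct.comul (R := k) (1 : H)) ∘ₗ
        TensorProduct.mk k H H 1

/-- A weak Hopf algebra structure on a `k`-algebra `H`. -/
class WeakHopfAlgebra (k H : Type*) [Field k] [Ring H] [Algebra k H]
    extends Coalgebra k H where
  /-- the antipode -/
  antipode : H →ₗ[k] H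
  /-- `Δ(hg) = Δ(h)Δ(g)` -/
  comul_mul : ∀ h g : H, comul (h * g) = comul h * comul g
  /-- `ε(hgf) = ε(h g₁) ε(g₂ f)` -/
  counit_mul_mul : ∀ h g f : H, counit (h * g * f) =
    LinearMap.mul' k k (TensorProduct.map (counit ∘ₗ LinearMap.mulLeft k h)
      (counit ∘ₗ LinearMap.mulRight k f) (comul g))
  /-- `ε(hgf) = ε(h g₂) ε(g₁ f)` -/
  counit_mul_mul' : ∀ h g f : H, counit (h * g * f) =
    LinearMap.mul' k k (TensorProduct.map (counit ∘ₗ LinearMap.mulRight k f)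
      (counit ∘ₗ LinearMap.mulLeft k h) (comul g))
  /-- `(Δ ⊗ id)Δ(1) = (Δ(1) ⊗ 1)(1 ⊗ Δ(1))` -/
  comul_one : comul.rTensor H (comul 1) =
    (comul 1 ⊗ₜ[k] (1 : H)) * (TensorProduct.assoc k H H H).symm ((1 : H) ⊗ₜ[k] comul 1)
  /-- `(Δ ⊗ id)Δ(1) = (1 ⊗ Δ(1))(Δ(1) ⊗ 1)` -/
  comul_one' : comul.rTensor H (comul 1) =
    (TensorProduct.assoc k H H H).symm ((1 : H) ⊗ₜ[k] comul 1) * (comul 1 ⊗ₜ[k] (1 : H))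
  /-- `h₁ S(h₂) = ε_t(h)` -/
  mul_antipode : ∀ h : H,
    LinearMap.mul' k H (antipode.lTensor H (comul h)) = targetCounit k H h
  /-- `S(h₁) h₂ = ε_s(h)` -/
  antipode_mul : ∀ h : H,
    LinearMap.mul' k H (antipode.rTensor H (comul h)) = sourceCounit k H h
  /-- `S(h₁) h₂ S(h₃) = S(h)` -/
  antipode_mul_antipode : ∀ h : H,
    LinearMap.mul' k H (TensorProduct.map (LinearMap.mul' k H ∘ₗ antipode.rTensor H) antipode
      (comul.rTensor H (comul h))) = antipode h

namespace WeakHopfAlgebra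

variable {k H : Type*} [Field k] [Ring H] [Algebra k H] [WeakHopfAlgebra k H]

open Coalgebra

theorem targetCounit_apply (h : H) : targetCounit k H h =
    TensorProduct.lid k H ((counit (R := k) (A := H)).rTensor H (comul 1 * h ⊗ₜ[k] 1)) := rfl

theorem comul_one_mul (h : H) : comul (R := k) (1 : H) * comul h = comul h := by
  rw [← comul_mul, one_mul]

theorem comul_target {z : H} (hz : targetCounit k H z = z) :
    comul (R := k) z = z ⊗ₜ[k] 1 * comul 1 := by
  have key : ∀ t : H ⊗[k] H, comul (R := k) (TensorProduct.lid k H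
      ((counit (R := k) (A := H)).rTensor H (t * z ⊗ₜ[k] 1))) =
      TensorProduct.lid k (H ⊗[k] H) ((counit (R := k) (A := H)).rTensor (H ⊗[k] H)
        ((comul.lTensor H t) * z ⊗ₜ[k] 1)) := by
    intro t
    induction t with
    | zero => simp
    | tmul a b => simp
    | add a b ha hb => simp only [add_mul, map_add, ha, hb]
  have key2 : ∀ s t : H ⊗[k] H, TensorProduct.lid k (H ⊗[k] H)
      ((counit (R := k) (A := H)).rTensor (H ⊗[k] H)
        ((TensorProduct.assoc k H H H
          ((s ⊗ₜ[k] (1 : H)) * (TensorProduct.assoc k H H H).symm ((1 : H) ⊗ₜ[k] t)))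
          * z ⊗ₜ[k] 1)) =
      (TensorProduct.lid k H
        ((counit (R := k) (A := H)).rTensor H (s * z ⊗ₜ[k] 1))) ⊗ₜ[k] 1 * t := by
    intro s t
    induction s with
    | zero => simp
    | add a b ha hb => simp only [add_mul, map_add, TensorProduct.add_tmul, ha, hb]
    | tmul a b =>
      induction t with
      | zero => simp
      | add a b ha hb => simp only [add_mul, mul_add, map_add, TensorProduct.tmul_add, ha, hb]
      | tmul c d => simp [TensorProduct.smul_tmul']
  conv_lhs => rw [← hz, targetCounit_apply, key, ← coassoc_apply, comul_one, key2,
    ← targetCounit_apply, hz]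

theorem comul_target' {z : H} (hz : targetCounit k H z = z) :
    comul (R := k) z = comul 1 * z ⊗ₜ[k] 1 := by
  have key : ∀ t : H ⊗[k] H, comul (R := k) (TensorProduct.lid k H
      ((counit (R := k) (A := H)).rTensor H (t * z ⊗ₜ[k] 1))) =
      TensorProduct.lid k (H ⊗[k] H) ((counit (R := k) (A := H)).rTensor (H ⊗[k] H)
        ((comul.lTensor H t) * z ⊗ₜ[k] 1)) := by
    intro t
    induction t with
    | zero => simp
    | tmul a b => simp
    | add a b ha hb => simp only [add_mul, map_add, ha, hb]
  have key2 : ∀ s t : H ⊗[k] H, TensorProduct.lid k (H ⊗[k] H)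
      ((counit (R := k) (A := H)).rTensor (H ⊗[k] H)
        ((TensorProduct.assoc k H H H
          ((TensorProduct.assoc k H H H).symm ((1 : H) ⊗ₜ[k] t) * (s ⊗ₜ[k] (1 : H))))
          * z ⊗ₜ[k] 1)) =
      t * (TensorProduct.lid k H
        ((counit (R := k) (A := H)).rTensor H (s * z ⊗ₜ[k] 1))) ⊗ₜ[k] 1 := by
    intro s t
    induction s with
    | zero => simp
    | add a b ha hb => simp only [add_mul, mul_add, map_add, TensorProduct.add_tmul, ha, hb]
    | tmul a b =>
      induction t with
      | zero => simp
      | add a b ha hb => simp only [add_mul, map_add, TensorProduct.tmul_add, ha, hb]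
      | tmul c d => simp [TensorProduct.smul_tmul']
  conv_lhs => rw [← hz, targetCounit_apply, key, ← coassoc_apply, comul_one', key2,
    ← targetCounit_apply, hz]

/-- `ε_t(h₁) h₂ = h` -/
theorem target_mul (h : H) :
    LinearMap.mul' k H ((targetCounit k H).rTensor H (comul h)) = h := by
  have key : ∀ s t : H ⊗[k] H, LinearMap.mul' k H
      ((((TensorProduct.lid k H).toLinearMap ∘ₗ (counit (R := k) (A := H)).rTensor H ∘ₗ
      LinearMap.mulLeft k s ∘ₗ (TensorProduct.mk k H H).flip 1)).rTensor H t) =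
      TensorProduct.lid k H ((counit (R := k) (A := H)).rTensor H (s * t)) := by
    intro s t
    induction s with
    | zero => simp
    | add a b ha hb =>
      rw [add_mul, map_add, map_add, ← ha, ← hb, ← map_add, ← LinearMap.add_apply,
        ← LinearMap.rTensor_add]
      congr 3
      ext x
      simp [add_mul]
    | tmul a b =>
      induction t with
      | zero => simp
      | add a b ha hb => simp only [mul_add, map_add, ha, hb]
      | tmul c d => simp
  rw [targetCounit, key, comul_one_mul]
  simp

theorem target_idem (h : H) : targetCounit k H (targetCounit k H h) = targetCounit k H h := by
  have key : ∀ s t : H ⊗[k] H, TensorProduct.lid k H ((counit (R := k) (A := H)).rTensor H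
      (t * (TensorProduct.lid k H ((counit (R := k) (A := H)).rTensor H (s * h ⊗ₜ[k] 1)))
        ⊗ₜ[k] 1)) =
      TensorProduct.lid k H ((LinearMap.mul' k k ∘ₗ
        TensorProduct.map (counit ∘ₗ LinearMap.mulRight k h) counit).rTensor H
        ((TensorProduct.assoc k H H H).symm (1 ⊗ₜ[k] t) * (s ⊗ₜ[k] (1 : H)))) := by
    intro s t
    induction s with
    | zero => simp
    | add a b ha hb => simp only [add_mul, mul_add, map_add, TensorProduct.add_tmul, ha, hb]
    | tmul a b =>
      induction t with
      | zero => simp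
      | add a b ha hb => simp only [add_mul, map_add, TensorProduct.tmul_add, ha, hb]
      | tmul c d => simp [← TensorProduct.smul_tmul', smul_smul]
  have key2 : ∀ t : H ⊗[k] H, TensorProduct.lid k H ((LinearMap.mul' k k ∘ₗ
        TensorProduct.map (counit ∘ₗ LinearMap.mulRight k h) counit).rTensor H
        (comul.rTensor H t)) = TensorProduct.lid k H ((counit (R := k) (A := H)).rTensor H
        (t * h ⊗ₜ[k] 1)) := by
    intro t
    induction t with
    | zero => simp
    | add a b ha hb => simp only [add_mul, map_add, ha, hb]
    | tmul a b =>
      have := counit_mul_mul' (k := k) 1 a h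
      simp only [one_mul, LinearMap.mulLeft_one, LinearMap.comp_id] at this
      simp [this]
  rw [targetCounit_apply (targetCounit k H h), targetCounit_apply h, key, ← comul_one', key2]

theorem target_one : targetCounit k H (1 : H) = 1 := by
  rw [targetCounit_apply, ← Algebra.TensorProduct.one_def, mul_one]; simp

/-- `1₁ ⊗ ε_t(1₂) = Δ(1)` -/
theorem lTensor_target_comul_one :
    (targetCounit k H).lTensor H (comul (R := k) (1 : H)) = comul 1 := by
  have key : ∀ s t : H ⊗[k] H, ((TensorProduct.lid k H).toLinearMap ∘ₗ
      (counit (R := k) (A := H)).rTensor H ∘ₗ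
      LinearMap.mulLeft k t ∘ₗ (TensorProduct.mk k H H).flip 1).lTensor H s =
      (TensorProduct.rid k H).toLinearMap.rTensor H ((counit.lTensor H).rTensor H
      ((TensorProduct.assoc k H H H).symm (1 ⊗ₜ[k] t) * (s ⊗ₜ[k] (1 : H)))) := by
    intro s t
    induction s with
    | zero => simp
    | add a b ha hb => simp only [mul_add, map_add, TensorProduct.add_tmul, ha, hb]
    | tmul a b =>
      induction t with
      | zero => simp
      | add a b ha hb =>
        simp only [add_mul, map_add, TensorProduct.tmul_add, ← ha, ← hb]
        simp [add_mul, TensorProduct.tmul_add]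
      | tmul c d => simp [TensorProduct.smul_tmul']
  have key2 : ∀ t : H ⊗[k] H, (TensorProduct.rid k H).toLinearMap.rTensor H
      ((counit.lTensor H).rTensor H (comul.rTensor H t)) = t := by
    intro t
    induction t with
    | zero => simp
    | add a b ha hb => simp only [map_add, ha, hb]
    | tmul a b => simp
  rw [targetCounit, key, ← comul_one', key2]

end WeakHopfAlgebra
end WeakHopf

section Smash

open Coalgebra WeakHopfAlgebra

/-- A left `H`-module algebra structure on the `k`-algebra `M`: `M` is a left `H`-module,
`h · (ab) = (h₁ · a)(h₂ · b)` and `h · 1 = ε_t(h) · 1`. -/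
structure WeakHopfAction (k H M : Type*) [Field k] [Ring H] [Algebra k H]
    [WeakHopfAlgebra k H] [Ring M] [Algebra k M] where
  /-- the action `h ⊗ m ↦ h · m` -/
  act : H →ₗ[k] M →ₗ[k] M
  one_act : ∀ m, act 1 m = m
  mul_act : ∀ h g m, act (h * g) m = act h (act g m)
  act_mul : ∀ h a b, act h (a * b) =
    LinearMap.mul' k M (TensorProduct.map (act.flip a) (act.flip b) (comul h))
  act_one : ∀ h, act h 1 = act (targetCounit k H h) 1

variable {k H M : Type*} [Field k] [Ring H] [Algebra k H] [WeakHopfAlgebra k H]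
  [Ring M] [Algebra k M]

/-- The relations `m(z · 1) ⊗ h = m ⊗ zh`, `z ∈ H_t`, defining `M ⊗_{H_t} H` as a quotient of
`M ⊗_k H`. -/
def smashRel (α : WeakHopfAction k H M) : Submodule k (M ⊗[k] H) :=
  Submodule.span k {t | ∃ (m : M) (z h : H), targetCounit k H z = z ∧
    t = (m * α.act z 1) ⊗ₜ[k] h - m ⊗ₜ[k] (z * h)}

/-- The underlying space `M ⊗_{H_t} H` of the smash product `M # H`. -/
def SmashProduct (α : WeakHopfAction k H M) : Type _ := (M ⊗[k] H) ⧸ smashRel α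

namespace SmashProduct

variable (α : WeakHopfAction k H M)

noncomputable instance : AddCommGroup (SmashProduct α) :=
  inferInstanceAs (AddCommGroup ((M ⊗[k] H) ⧸ smashRel α))

noncomputable instance : Module k (SmashProduct α) :=
  inferInstanceAs (Module k ((M ⊗[k] H) ⧸ smashRel α))

/-- The projection `M ⊗_k H → M # H`. -/
noncomputable def proj : M ⊗[k] H →ₗ[k] SmashProduct α := (smashRel α).mkQ

/-- The class `m # h` of `m ⊗ h`. -/
noncomputable def mk (m : M) (h : H) : SmashProduct α := proj α (m ⊗ₜ[k] h)

theorem proj_surjective : Function.Surjective (proj α) := (smashRel α).mkQ_surjective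

theorem proj_rel (m : M) {z : H} (hz : targetCounit k H z = z) (h : H) :
    proj α ((m * α.act z 1) ⊗ₜ[k] h) = proj α (m ⊗ₜ[k] (z * h)) :=
  (Submodule.Quotient.eq _).2 (Submodule.subset_span ⟨m, z, h, hz, rfl⟩)

/-- `m (h₁ · b) ⊗ h₂ g` -/
noncomputable def mulElem (m : M) (h : H) (b : M) (g : H) : M ⊗[k] H :=
  TensorProduct.map (LinearMap.mulLeft k m ∘ₗ α.act.flip b) (LinearMap.mulRight k g) (comul h)

theorem map_eq (m b : M) (g : H) (t : H ⊗[k] H) :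
    TensorProduct.map (LinearMap.mulLeft k m ∘ₗ α.act.flip b) (LinearMap.mulRight k g) t =
    (m ⊗ₜ[k] (1 : H)) * TensorProduct.map (α.act.flip b) LinearMap.id t * ((1 : M) ⊗ₜ[k] g) := by
  induction t with
  | zero => simp
  | add a b ha hb => simp only [map_add, mul_add, add_mul, ha, hb]
  | tmul a b => simp

theorem mulElem_eq (m : M) (h : H) (b : M) (g : H) : mulElem α m h b g =
    (m ⊗ₜ[k] (1 : H)) * TensorProduct.map (α.act.flip b) LinearMap.id (comul h) *
      ((1 : M) ⊗ₜ[k] g) := map_eq α m b g _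

/-- The bilinear extension of `(m ⊗ h, b ⊗ g) ↦ m (h₁ · b) ⊗ h₂ g`. -/
noncomputable def preMul : M ⊗[k] H →ₗ[k] M ⊗[k] H →ₗ[k] M ⊗[k] H :=
  TensorProduct.lift (LinearMap.mk₂ k
    (fun m h => TensorProduct.lift (LinearMap.mk₂ k (fun b g => mulElem α m h b g)
      (fun b b' g => by
        simp only [mulElem_eq, map_add, TensorProduct.map_add_left, LinearMap.add_apply, mul_add,
          add_mul])
      (fun c b g => by
        simp only [mulElem_eq, map_smul, TensorProduct.map_smul_left, LinearMap.smul_apply,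
          mul_smul_comm, smul_mul_assoc])
      (fun b g g' => by simp only [mulElem_eq, TensorProduct.tmul_add, mul_add])
      (fun c b g => by simp only [mulElem_eq, TensorProduct.tmul_smul, mul_smul_comm])))
    (fun m m' h => by
      ext b g; simp [mulElem_eq, TensorProduct.add_tmul, add_mul])
    (fun c m h => by
      ext b g; simp [mulElem_eq, ← TensorProduct.smul_tmul'])
    (fun m h h' => by
      ext b g; simp [mulElem_eq, mul_add, add_mul])
    (fun c m h => by
      ext b g; simp [mulElem_eq]))

theorem preMul_tmul (m : M) (h : H) (b : M) (g : H) :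
    preMul α (m ⊗ₜ[k] h) (b ⊗ₜ[k] g) = mulElem α m h b g := by
  simp [preMul]

/-- `z · c = (z · 1) c` for `z ∈ H_t` -/
theorem act_target {z : H} (hz : targetCounit k H z = z) (c : M) :
    α.act z c = α.act z 1 * c := by
  have key : ∀ t : H ⊗[k] H, LinearMap.mul' k M (TensorProduct.map (α.act.flip 1) (α.act.flip c)
      (t * z ⊗ₜ[k] 1)) = LinearMap.mul' k M (TensorProduct.map (α.act.flip (α.act z 1))
        (α.act.flip c) t) := by
    intro t
    induction t with
    | zero => simp
    | add a b ha hb => simp only [map_add, add_mul, ha, hb]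
    | tmul a b => simp [α.mul_act]
  have h := α.act_mul z 1 c
  rw [one_mul, comul_target' hz, key, ← α.act_mul, α.one_act] at h
  exact h

theorem preMul_rel_left {t : M ⊗[k] H} (ht : t ∈ smashRel α) (y : M ⊗[k] H) :
    proj α (preMul α t y) = 0 := by
  induction ht using Submodule.span_induction with
  | zero => simp
  | add a b _ _ ha hb => simp only [map_add, LinearMap.add_apply, ha, hb, add_zero]
  | smul c a _ ha => simp only [map_smul, LinearMap.smul_apply, ha, smul_zero]
  | mem t ht =>
    obtain ⟨m, z, h, hz, rfl⟩ := ht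
    rw [map_sub, LinearMap.sub_apply, map_sub, sub_eq_zero]
    induction y with
    | zero => simp
    | add a b ha hb => simp only [map_add, ha, hb]
    | tmul b g =>
      rw [preMul_tmul, preMul_tmul, mulElem_eq, mulElem_eq, comul_mul, comul_target hz,
        mul_assoc (z ⊗ₜ[k] (1 : H)), comul_one_mul]
      congr 1
      congr 1
      generalize (comul (R := k) h) = t
      induction t with
      | zero => simp
      | add a b ha hb => simp only [map_add, mul_add, ha, hb]
      | tmul c d => simp [α.mul_act, mul_assoc, act_target α hz (α.act c b)]

theorem proj_target_mul (m : M) (t : H ⊗[k] H) (l : H) :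
    proj α (TensorProduct.map (LinearMap.mulLeft k m ∘ₗ α.act.flip 1)
      (LinearMap.mulRight k l) t) =
    proj α (m ⊗ₜ[k] (LinearMap.mul' k H ((targetCounit k H).rTensor H t) * l)) := by
  induction t with
  | zero => simp
  | add a b ha hb => simp only [map_add, add_mul, TensorProduct.tmul_add, ha, hb]
  | tmul a b =>
    have := proj_rel α m (target_idem (k := k) a) (b * l)
    simp only [TensorProduct.map_tmul, LinearMap.comp_apply, LinearMap.mulLeft_apply,
      LinearMap.flip_apply, LinearMap.mulRight_apply, LinearMap.rTensor_tmul,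
      LinearMap.mul'_apply]
    rw [α.act_one a, this, mul_assoc]

theorem preMul_rel_right (x : M ⊗[k] H) {t : M ⊗[k] H} (ht : t ∈ smashRel α) :
    proj α (preMul α x t) = 0 := by
  induction ht using Submodule.span_induction with
  | zero => simp
  | add a b _ _ ha hb => simp only [map_add, ha, hb, add_zero]
  | smul c a _ ha => simp only [map_smul, ha, smul_zero]
  | mem t ht =>
    obtain ⟨b, z, g, hz, rfl⟩ := ht
    rw [map_sub, map_sub, sub_eq_zero]
    induction x with
    | zero => simp
    | add a b ha hb => simp only [map_add, LinearMap.add_apply, ha, hb]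
    | tmul m h =>
      rw [preMul_tmul, preMul_tmul]
      -- `m (h₁ · (b (z · 1))) ⊗ h₂ g = m (h₁ · b) ((h₂ z) · 1) ⊗ h₃ g`
      have h1 : ∀ s : H ⊗[k] H, TensorProduct.map
          (LinearMap.mulLeft k m ∘ₗ α.act.flip (b * α.act z 1)) (LinearMap.mulRight k g) s =
          (TensorProduct.map (LinearMap.mulLeft k m ∘ₗ LinearMap.mul' k M ∘ₗ
            TensorProduct.map (α.act.flip b) (α.act.flip (α.act z 1))) (LinearMap.mulRight k g))
            (comul.rTensor H s) := by
        intro s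
        induction s with
        | zero => simp
        | add a b ha hb => simp only [map_add, ha, hb]
        | tmul c d => simp [α.act_mul]
      have h2 : ∀ s : H ⊗[k] (H ⊗[k] H), proj α ((TensorProduct.map
            (LinearMap.mulLeft k m ∘ₗ LinearMap.mul' k M ∘ₗ
            TensorProduct.map (α.act.flip b) (α.act.flip (α.act z 1))) (LinearMap.mulRight k g))
            ((TensorProduct.assoc k H H H).symm s)) =
          proj α (TensorProduct.map (LinearMap.mulLeft k m ∘ₗ α.act.flip b)
            (LinearMap.mulRight k g ∘ₗ LinearMap.mul' k H ∘ₗ (targetCounit k H).rTensor H ∘ₗ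
              LinearMap.mulRight k (z ⊗ₜ[k] (1 : H))) s) := by
        intro s
        induction s with
        | zero => simp
        | add a b ha hb => simp only [map_add, ha, hb]
        | tmul c d =>
          induction d with
          | zero => simp
          | add a b ha hb => simp only [map_add, TensorProduct.tmul_add, ha, hb]
          | tmul d e =>
            have := proj_target_mul α (m * α.act c b) ((d * z) ⊗ₜ[k] e) g
            simpa [α.mul_act, mul_assoc] using this
      have h3 : ∀ s : H ⊗[k] H, (TensorProduct.map (LinearMap.mulLeft k m ∘ₗ α.act.flip b)
            (LinearMap.mulRight k g ∘ₗ LinearMap.mul' k H ∘ₗ (targetCounit k H).rTensor H ∘ₗ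
              LinearMap.mulRight k (z ⊗ₜ[k] (1 : H)))) (comul.lTensor H s) =
          TensorProduct.map (LinearMap.mulLeft k m ∘ₗ α.act.flip b)
            (LinearMap.mulRight k (z * g)) s := by
        intro s
        induction s with
        | zero => simp
        | add a b ha hb => simp only [map_add, ha, hb]
        | tmul c d =>
          have e : comul (R := k) d * z ⊗ₜ[k] (1 : H) = comul (d * z) := by
            rw [comul_mul, comul_target' hz, ← mul_assoc, ← comul_mul, mul_one]
          simp [e, target_mul, mul_assoc]
      rw [mulElem, mulElem, h1, ← coassoc_symm_apply, h2, h3]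

/-- The multiplication `(m # h)(b # g) = m (h₁ · b) # h₂ g` of the smash product. -/
noncomputable def mulHom : SmashProduct α →ₗ[k] SmashProduct α →ₗ[k] SmashProduct α :=
  (smashRel α).liftQ ((smashRel α).liftQ ((preMul α).compr₂ (proj α)).flip
    (fun _ ht => LinearMap.ext fun x => preMul_rel_right α x ht)).flip
    (fun t ht => by
      ext1 y
      obtain ⟨y, rfl⟩ := proj_surjective α y
      exact preMul_rel_left α ht y)

theorem mulHom_proj (x y : M ⊗[k] H) :
    mulHom α (proj α x) (proj α y) = proj α (preMul α x y) := rfl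

theorem mulHom_assoc (x y z : SmashProduct α) :
    mulHom α (mulHom α x y) z = mulHom α x (mulHom α y z) := by
  obtain ⟨x, rfl⟩ := proj_surjective α x
  obtain ⟨y, rfl⟩ := proj_surjective α y
  obtain ⟨z, rfl⟩ := proj_surjective α z
  simp only [mulHom_proj]
  congr 1
  induction x with
  | zero => simp
  | add a b ha hb => simp only [map_add, LinearMap.add_apply, ha, hb]
  | tmul m h =>
  induction y with
  | zero => simp
  | add a b ha hb => simp only [map_add, LinearMap.add_apply, ha, hb]
  | tmul b g =>
  induction z with
  | zero => simp
  | add a b ha hb => simp only [map_add, ha, hb]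
  | tmul c l =>
  rw [preMul_tmul, preMul_tmul]
  -- both sides are `m (h₁ · b) ((h₂ g₁) · c) ⊗ h₃ g₂ l`
  have h1 : ∀ s : H ⊗[k] H, preMul α (TensorProduct.map (LinearMap.mulLeft k m ∘ₗ α.act.flip b)
      (LinearMap.mulRight k g) s) (c ⊗ₜ[k] l) =
      (m ⊗ₜ[k] (1 : H)) * (LinearMap.mul' k (M ⊗[k] H)
        (TensorProduct.map ((TensorProduct.mk k M H).flip 1 ∘ₗ α.act.flip b)
          (TensorProduct.map (α.act.flip c) LinearMap.id ∘ₗ LinearMap.mulRight k (comul g))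
          (comul.lTensor H s))) * ((1 : M) ⊗ₜ[k] l) := by
    intro s
    induction s with
    | zero => simp
    | add a b ha hb => simp only [map_add, LinearMap.add_apply, mul_add, add_mul, ha, hb]
    | tmul a d =>
      simp only [TensorProduct.map_tmul, LinearMap.comp_apply, LinearMap.mulLeft_apply,
        LinearMap.flip_apply, LinearMap.mulRight_apply, preMul_tmul, mulElem_eq, comul_mul,
        LinearMap.lTensor_tmul, LinearMap.mul'_apply, TensorProduct.mk_apply]
      simp only [← mul_assoc, Algebra.TensorProduct.tmul_mul_tmul, mul_one]
  have h2 : ∀ s : H ⊗[k] H, preMul α (m ⊗ₜ[k] h) (TensorProduct.map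
      (LinearMap.mulLeft k b ∘ₗ α.act.flip c) (LinearMap.mulRight k l) s) =
      (m ⊗ₜ[k] (1 : H)) * (LinearMap.mul' k (M ⊗[k] H)
        (TensorProduct.map ((TensorProduct.mk k M H).flip 1 ∘ₗ α.act.flip b)
          (TensorProduct.map (α.act.flip c) LinearMap.id ∘ₗ LinearMap.mulRight k s)
          (TensorProduct.assoc k H H H (comul.rTensor H (comul h))))) * ((1 : M) ⊗ₜ[k] l) := by
    intro s
    induction s with
    | zero => simp
    | add a b ha hb =>
      rw [map_add, map_add, ha, hb, ← add_mul, ← mul_add, ← map_add, ← LinearMap.add_apply,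
        ← TensorProduct.map_add_right, ← LinearMap.comp_add]
      congr 6
      exact LinearMap.ext fun x => by simp [mul_add]
    | tmul a d =>
      simp only [TensorProduct.map_tmul, LinearMap.comp_apply, LinearMap.mulLeft_apply,
        LinearMap.flip_apply, LinearMap.mulRight_apply, preMul_tmul, mulElem_eq]
      generalize (comul (R := k) h) = t
      induction t with
      | zero => simp
      | add a b ha hb => simp only [map_add, mul_add, add_mul, ha, hb]
      | tmul x y =>
        simp only [TensorProduct.map_tmul, LinearMap.flip_apply, LinearMap.rTensor_tmul,
          LinearMap.id_apply, α.act_mul]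
        generalize (comul (R := k) x) = t
        induction t with
        | zero => simp
        | add a b ha hb =>
          simp only [map_add, mul_add, add_mul, TensorProduct.add_tmul, ha, hb]
        | tmul x x' => simp [α.mul_act, mul_assoc]
  rw [mulElem, mulElem, h1, h2, coassoc_apply]

theorem mulHom_one (x : SmashProduct α) : mulHom α x (mk α 1 1) = x := by
  obtain ⟨x, rfl⟩ := proj_surjective α x
  rw [mk, mulHom_proj]
  induction x with
  | zero => simp
  | add a b ha hb => simp only [map_add, LinearMap.add_apply, ha, hb]
  | tmul m h => rw [preMul_tmul, mulElem, proj_target_mul, target_mul, mul_one]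

theorem one_mulHom (x : SmashProduct α) : mulHom α (mk α 1 1) x = x := by
  obtain ⟨x, rfl⟩ := proj_surjective α x
  rw [mk, mulHom_proj]
  induction x with
  | zero => simp
  | add a b ha hb => simp only [map_add, ha, hb]
  | tmul b g =>
    have h1 : ∀ t : H ⊗[k] H, proj α (TensorProduct.map
        (LinearMap.mulLeft k 1 ∘ₗ α.act.flip b) (LinearMap.mulRight k g)
        ((targetCounit k H).lTensor H t)) =
        proj α ((LinearMap.mul' k M (TensorProduct.map (α.act.flip b) (α.act.flip 1) t))
          ⊗ₜ[k] g) := by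
      intro t
      induction t with
      | zero => simp
      | add a b ha hb => simp only [map_add, TensorProduct.add_tmul, ha, hb]
      | tmul a d =>
        have := proj_rel α (α.act a b) (target_idem (k := k) d) g
        rw [← α.act_one] at this
        simpa using this.symm
    rw [preMul_tmul, mulElem, ← lTensor_target_comul_one, h1, ← α.act_mul, α.one_act, mul_one]

noncomputable instance : Ring (SmashProduct α) :=
  { (inferInstance : AddCommGroup (SmashProduct α)) with
    mul := fun x y => mulHom α x y
    one := mk α 1 1
    left_distrib := fun x y z => map_add (mulHom α x) y z
    right_distrib := fun x y z => LinearMap.map_add₂ (mulHom α) x y z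
    zero_mul := fun x => LinearMap.map_zero₂ (mulHom α) x
    mul_zero := fun x => map_zero (mulHom α x)
    mul_assoc := mulHom_assoc α
    one_mul := one_mulHom α
    mul_one := mulHom_one α }

noncomputable instance : Algebra k (SmashProduct α) :=
  Algebra.ofModule (fun c x y => LinearMap.map_smul₂ (mulHom α) c x y)
    (fun c x y => map_smul (mulHom α x) c y)

theorem mk_mul_mk (m : M) (h : H) (b : M) (g : H) : mk α m h * mk α b g =
    proj α (TensorProduct.map (LinearMap.mulLeft k m ∘ₗ α.act.flip b)
      (LinearMap.mulRight k g) (comul h)) :=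
  (mulHom_proj α _ _).trans (congrArg (proj α) (preMul_tmul α m h b g))

theorem one_def : (1 : SmashProduct α) = mk α 1 1 := rfl

end SmashProduct
end Smash

section JonesTower

variable {k N M : Type*} [Field k] [Ring N] [Ring M] [Algebra k N] [Algebra k M]

/-- The centralizer of the image of `j`. -/
def cent (j : N →ₐ[k] M) : Subalgebra k M := Subalgebra.centralizer k (Set.range j)

/-- `End(M_N)`: the endomorphisms of `M` as a right `N`-module. -/
def endRight (ι : N →ₐ[k] M) : Subalgebra k (Module.End k M) where
  carrier := {f | ∀ (m : M) (n : N), f (m * ι n) = f m * ι n}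
  mul_mem' := fun {f g} hf hg m n => by
    simp only [Set.mem_ofPred_eq] at hf hg
    simp [hf, hg]
  add_mem' := fun {f g} hf hg m n => by
    simp only [Set.mem_ofPred_eq] at hf hg
    simp [hf, hg, add_mul]
  algebraMap_mem' := fun c m n => by simp [Module.algebraMap_end_apply]

/-- The algebra `End(M_N)`, as a type. -/
def EndRight (ι : N →ₐ[k] M) : Type _ := endRight ι

instance (ι : N →ₐ[k] M) : Ring (EndRight ι) := inferInstanceAs (Ring (endRight ι))

instance (ι : N →ₐ[k] M) : Algebra k (EndRight ι) := inferInstanceAs (Algebra k (endRight ι))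

/-- An element of `End(M_N)` as a `k`-linear map. -/
def EndRight.val {ι : N →ₐ[k] M} : EndRight ι →ₐ[k] Module.End k M := (endRight ι).val

@[ext]
theorem EndRight.ext {ι : N →ₐ[k] M} {f g : EndRight ι} (h : ∀ m, f.val m = g.val m) : f = g :=
  Subtype.ext (LinearMap.ext h)

theorem EndRight.val_mul_apply {ι : N →ₐ[k] M} (f g : EndRight ι) (m : M) :
    (f * g).val m = f.val (g.val m) := rfl

theorem EndRight.val_apply_mul {ι : N →ₐ[k] M} (f : EndRight ι) (m : M) (n : N) :
    f.val (m * ι n) = f.val m * ι n := f.2 m n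

/-- The embedding `M ↪ End(M_N)` by left multiplications. -/
def leftMul (ι : N →ₐ[k] M) : M →ₐ[k] EndRight ι :=
  (Algebra.lmul k M).codRestrict (endRight ι) (fun a m n => by simp [mul_assoc])

theorem leftMul_apply (ι : N →ₐ[k] M) (a m : M) : (leftMul ι a).val m = a * m := rfl

/-- A strongly separable extension `ι : N → M` of `k`-algebras, with its Frobenius coordinates
`E`, `x_i`, `y_i` and its index `λ⁻¹`. (The map `ι` is then injective, since `E ∘ ι = id`.) -/
structure StronglySeparableExt (ι : N →ₐ[k] M) where
  /-- the Frobenius homomorphism -/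
  E : M →ₗ[k] N
  E_left : ∀ (n : N) (m : M), E (ι n * m) = n * E m
  E_right : ∀ (m : M) (n : N), E (m * ι n) = E m * n
  /-- the number of elements of the dual bases -/
  r : ℕ
  /-- the first dual basis -/
  x : Fin r → M
  /-- the second dual basis -/
  y : Fin r → M
  dual_left : ∀ m, ∑ i, ι (E (m * x i)) * y i = m
  dual_right : ∀ m, ∑ i, x i * ι (E (y i * m)) = m
  E_one : E 1 = 1
  /-- the reciprocal of the index -/
  lam : k
  lam_ne_zero : lam ≠ 0
  sum_mul : ∑ i, x i * y i = algebraMap k M lam⁻¹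

namespace StronglySeparableExt

variable {ι : N →ₐ[k] M} (X : StronglySeparableExt ι)

/-- The Jones idempotent `e₁`, that is, `E` as an endomorphism of `M_N`. -/
def e : EndRight ι :=
  ⟨ι.toLinearMap ∘ₗ X.E, fun m n => by simp [X.E_right]⟩

theorem e_apply (m : M) : X.e.val m = ι (X.E m) := rfl

/-- The conditional expectation `E_M : End(M_N) → M`, `E_M(f) = λ ∑ f(x_i) y_i`. -/
noncomputable def condExp : EndRight ι →ₗ[k] M :=
  X.lam • ∑ i, LinearMap.mulRight k (X.y i) ∘ₗ LinearMap.applyₗ (X.x i) ∘ₗ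
    EndRight.val.toLinearMap

theorem condExp_apply (f : EndRight ι) :
    X.condExp f = X.lam • ∑ i, f.val (X.x i) * X.y i := by
  simp [condExp, LinearMap.sum_apply]

/-- `E_M` is the map `m e₁ m' ↦ λ m m'`. -/
theorem condExp_mul_e_mul (m m' : M) :
    X.condExp (leftMul ι m * X.e * leftMul ι m') = X.lam • (m * m') := by
  rw [condExp_apply]
  simp only [EndRight.val_mul_apply, leftMul_apply, e_apply, mul_assoc m,
    ← Finset.mul_sum, X.dual_left]

theorem apply_eq_sum (f : EndRight ι) (m : M) :
    f.val m = ∑ i, f.val (X.x i) * ι (X.E (X.y i * m)) := by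
  conv_lhs => rw [← X.dual_right m, map_sum]
  exact Finset.sum_congr rfl fun i _ => f.val_apply_mul _ _

theorem E_incl (n : N) : X.E (ι n) = n := by
  rw [← mul_one (ι n), X.E_left, X.E_one, mul_one]

/-- The basic construction: `M₁ = End(M_N)` is a strongly separable extension of `M` with
Frobenius homomorphism `E_M`, dual bases `λ⁻¹ x_i e₁`, `e₁ y_i` and the same index. -/
noncomputable def basic : StronglySeparableExt (leftMul ι) where
  E := X.condExp
  E_left := fun a f => by
    simp only [condExp_apply, EndRight.val_mul_apply, leftMul_apply,
      mul_assoc, ← Finset.mul_sum, mul_smul_comm]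
  E_right := fun f a => by
    simp only [condExp_apply, EndRight.val_mul_apply, leftMul_apply,
      smul_mul_assoc]
    congr 1
    calc ∑ i, f.val (a * X.x i) * X.y i
        = ∑ i, ∑ j, f.val (X.x j) * ι (X.E (X.y j * (a * X.x i))) * X.y i :=
          Finset.sum_congr rfl fun i _ => by rw [X.apply_eq_sum f (a * X.x i), Finset.sum_mul]
      _ = ∑ j, f.val (X.x j) * (X.y j * a) := by
          rw [Finset.sum_comm]
          refine Finset.sum_congr rfl fun j _ => ?_
          simp only [mul_assoc (f.val (X.x j)), ← Finset.mul_sum, ← mul_assoc (X.y j)]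
          rw [X.dual_left]
      _ = _ := by simp only [Finset.sum_mul, mul_assoc]
  r := X.r
  x := fun i => X.lam⁻¹ • (leftMul ι (X.x i) * X.e)
  y := fun i => X.e * leftMul ι (X.y i)
  dual_left := fun f => by
    have h : ∀ i, X.condExp (f * (X.lam⁻¹ • (leftMul ι (X.x i) * X.e))) =
        f.val (X.x i) := fun i => by
      rw [mul_smul_comm, map_smul, condExp_apply, smul_smul, inv_mul_cancel₀ X.lam_ne_zero,
        one_smul]
      conv_rhs => rw [← mul_one (f.val (X.x i)), ← X.dual_left 1, Finset.mul_sum]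
      refine Finset.sum_congr rfl fun j _ => ?_
      simp only [EndRight.val_mul_apply, leftMul_apply, e_apply, one_mul,
        ← mul_assoc]
      rw [f.val_apply_mul]
    ext m
    simp only [h, map_sum, LinearMap.sum_apply, EndRight.val_mul_apply, leftMul_apply, e_apply]
    exact (X.apply_eq_sum f m).symm
  dual_right := fun f => by
    ext m
    simp only [map_sum, LinearMap.sum_apply, EndRight.val_mul_apply, leftMul_apply, e_apply,
      condExp_apply, smul_mul_assoc, map_smul, mul_smul_comm, ← Finset.smul_sum, smul_smul,
      mul_inv_cancel₀ X.lam_ne_zero, one_smul, Finset.mul_sum]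
    rw [Finset.sum_comm, X.apply_eq_sum f m]
    refine Finset.sum_congr rfl fun j _ => ?_
    rw [← X.dual_right (f.val (X.x j)), Finset.sum_mul]
    refine Finset.sum_congr rfl fun i _ => ?_
    rw [X.dual_right, mul_assoc, X.E_left, map_mul, mul_assoc]
  E_one := by
    simp only [condExp_apply, map_one, Module.End.one_apply, X.sum_mul]
    rw [Algebra.algebraMap_eq_smul_one, smul_smul, mul_inv_cancel₀ X.lam_ne_zero, one_smul]
  lam := X.lam
  lam_ne_zero := X.lam_ne_zero
  sum_mul := by
    ext m
    simp only [smul_mul_assoc, map_sum, map_smul, LinearMap.sum_apply, LinearMap.smul_apply,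
      EndRight.val_mul_apply, leftMul_apply, e_apply, X.E_incl, AlgHom.commutes,
      Module.algebraMap_end_apply]
    rw [← Finset.smul_sum, X.dual_right]

theorem basic_E_mul_e_mul (m m' : M) :
    X.basic.E (leftMul ι m * X.e * leftMul ι m') = X.lam • (m * m') :=
  X.condExp_mul_e_mul m m'

/-- `T : N → k` is a Markov trace: a trace with `T(1) = 1` such that `T ∘ E` is a trace on `M`. -/
def IsMarkovTrace (T : N →ₗ[k] k) : Prop :=
  (∀ n n', T (n * n') = T (n' * n)) ∧ T 1 = 1 ∧
    ∀ m m', T (X.E (m * m')) = T (X.E (m' * m))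

/-- `E(um) = E(mu)` for all `u` in the centralizer `U = C_M(N)` and all `m ∈ M`. -/
def IsSymmetric : Prop := ∀ u ∈ cent ι, ∀ m, X.E (u * m) = X.E (m * u)

/-- The map `φ : u ↦ ∑ x_i u e₁ y_i` from `M` to `M₁`. On `U` it is the standard
anti-isomorphism `U → V`. -/
def phi (u : M) : EndRight ι := ∑ i, leftMul ι (X.x i * u) * X.e * leftMul ι (X.y i)

/-- The trace `T₀ = T ∘ E` on `M`. -/
def trace₀ (T : N →ₗ[k] k) : M →ₗ[k] k := T ∘ₗ X.E

/-- The trace `T₁ = T ∘ E ∘ E_M` on `M₁`. -/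
noncomputable def trace₁ (T : N →ₗ[k] k) : EndRight ι →ₗ[k] k := X.trace₀ T ∘ₗ X.basic.E

/-- The trace `T₂ = T ∘ E ∘ E_M ∘ E_{M₁}` on `M₂`. -/
noncomputable def trace₂ (T : N →ₗ[k] k) : EndRight (leftMul ι) →ₗ[k] k :=
  X.trace₁ T ∘ₗ X.basic.basic.E

end StronglySeparableExt

/-- `f` is a symmetric separability element of `R`. -/
def IsSymmSepElement (k : Type*) {R : Type*} [Field k] [Ring R] [Algebra k R]
    (f : R ⊗[k] R) : Prop :=
  LinearMap.mul' k R f = 1 ∧ TensorProduct.comm k R R f = f ∧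
    ∀ r : R, (r ⊗ₜ[k] 1) * f = f * (1 ⊗ₜ[k] r)

/-- A `k`-algebra is Kanzaki separable if it has a symmetric separability element. -/
def IsKanzakiSeparable (k R : Type*) [Field k] [Ring R] [Algebra k R] : Prop :=
  ∃ f : R ⊗[k] R, IsSymmSepElement k f

theorem IsSymmSepElement.unique {k R : Type*} [Field k] [Ring R] [Algebra k R]
    {f g : R ⊗[k] R} (hf : IsSymmSepElement k f) (hg : IsSymmSepElement k g) : f = g := by
  -- both are equal to `∑ f₁ g₁ ⊗ g₂ f₂`
  let Q : R ⊗[k] R →ₗ[k] R ⊗[k] R →ₗ[k] R ⊗[k] R := TensorProduct.lift (LinearMap.mk₂ k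
    (fun a b => TensorProduct.map (LinearMap.mulLeft k a) (LinearMap.mulRight k b))
    (fun a a' b => by ext; simp [add_mul, TensorProduct.add_tmul])
    (fun c a b => by ext; simp [TensorProduct.smul_tmul'])
    (fun a b b' => by ext; simp [mul_add, TensorProduct.tmul_add])
    (fun c a b => by ext; simp))
  have hQ : ∀ a b c d : R, Q (a ⊗ₜ b) (c ⊗ₜ d) = (a * c) ⊗ₜ[k] (d * b) := fun a b c d => by
    simp [Q]
  have h1 : ∀ s : R ⊗[k] R, Q s g = g * (1 ⊗ₜ[k] LinearMap.mul' k R s) := by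
    intro s
    induction s with
    | zero => simp
    | add a b ha hb => simp only [map_add, LinearMap.add_apply, TensorProduct.tmul_add, mul_add,
        ha, hb]
    | tmul a b =>
      have e : ∀ t : R ⊗[k] R, Q (a ⊗ₜ b) t = (a ⊗ₜ[k] 1) * t * (1 ⊗ₜ[k] b) := by
        intro t
        induction t with
        | zero => simp
        | add a b ha hb => simp only [map_add, mul_add, add_mul, ha, hb]
        | tmul c d => simp [hQ]
      rw [e, hg.2.2, mul_assoc]
      simp
  have hf' : ∀ r : R, (1 ⊗ₜ[k] r) * f = f * (r ⊗ₜ[k] 1) := by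
    intro r
    have := congrArg (Algebra.TensorProduct.comm k R R) (hf.2.2 r)
    have hc : Algebra.TensorProduct.comm k R R f = f := hf.2.1
    simpa [hc] using this
  have h2 : ∀ t : R ⊗[k] R, Q f t =
      (1 ⊗ₜ[k] LinearMap.mul' k R (TensorProduct.comm k R R t)) * f := by
    intro t
    induction t with
    | zero => simp
    | add a b ha hb => simp only [map_add, TensorProduct.tmul_add, add_mul, ha, hb]
    | tmul c d =>
      have e : ∀ s : R ⊗[k] R, Q s (c ⊗ₜ d) = (1 ⊗ₜ[k] d) * (s * (c ⊗ₜ[k] 1)) := by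
        intro s
        induction s with
        | zero => simp
        | add a b ha hb => simp only [map_add, LinearMap.add_apply, mul_add, add_mul, ha, hb]
        | tmul c d => simp [hQ]
      rw [e, ← hf', ← mul_assoc]
      simp
  have h3 := h1 f
  rw [h2, hf.1, hg.2.1, hg.1, ← Algebra.TensorProduct.one_def, one_mul, mul_one] at h3
  exact h3

/-- The symmetric separability element of a Kanzaki separable algebra (it is unique). -/
noncomputable def symmSepElement (k R : Type*) [Field k] [Ring R] [Algebra k R] : R ⊗[k] R :=
  Classical.epsilon (fun f : R ⊗[k] R => IsSymmSepElement k f)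

/-- The map `j : R → S` being fixed, `F : S → R` has dual bases `z_i`, `w_i` in the subset `A`
of `S`: `F(s z_i) w_i = s = z_i F(w_i s)`, summed over `i`. -/
def HasDualBasesIn {R S : Type*} [Ring R] [Ring S] [Algebra k R] [Algebra k S]
    (j : R →ₐ[k] S) (F : S →ₗ[k] R) (A : Subalgebra k S) : Prop :=
  ∃ (n : ℕ) (z w : Fin n → S), (∀ i, z i ∈ A) ∧ (∀ i, w i ∈ A) ∧
    ∀ s, ∑ i, j (F (s * z i)) * w i = s ∧ ∑ i, z i * j (F (w i * s)) = s

/-- `V = C_{M₁}(M)` -/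
abbrev centV (ι : N →ₐ[k] M) : Subalgebra k (EndRight ι) := cent (leftMul ι)

/-- `A = C_{M₁}(N)` -/
abbrev centA (ι : N →ₐ[k] M) : Subalgebra k (EndRight ι) := cent ((leftMul ι).comp ι)

/-- `B = C_{M₂}(M)`, where `M₂ = End((M₁)_M)` -/
abbrev centB (ι : N →ₐ[k] M) : Subalgebra k (EndRight (leftMul ι)) :=
  cent ((leftMul (leftMul ι)).comp (leftMul ι))

namespace StronglySeparableExt

variable {ι : N →ₐ[k] M} (X : StronglySeparableExt ι) (T : N →ₗ[k] k)

/-- The (weak) depth `2` property: `E_M` has dual bases in `A` and `E_{M₁}` has dual bases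
in `B`. -/
def HasDepthTwo : Prop :=
  HasDualBasesIn (leftMul ι) X.basic.E (centA ι) ∧
    HasDualBasesIn (leftMul (leftMul ι))
      X.basic.basic.E (centB ι)

/-- The element `w = [f⁽¹⁾ T₁(f⁽²⁾)]⁻¹` of `V`, where `f` is the symmetric separability element
of `V`. -/
noncomputable def w : centV ι :=
  Ring.inverse (TensorProduct.rid k (centV ι)
    ((X.trace₁ T ∘ₗ (centV ι).val.toLinearMap).lTensor (centV ι) (symmSepElement k (centV ι))))

/-- The pairing `⟨a, b⟩ = λ⁻² T₂(a e₂ e₁ w b)` of `A` and `B`. -/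
noncomputable def pairing : centA ι →ₗ[k] centB ι →ₗ[k] k :=
  LinearMap.mk₂ k
    (fun a b => X.lam⁻¹ ^ 2 * X.trace₂ T (leftMul (leftMul ι) a * X.basic.e *
      leftMul (leftMul ι) X.e * leftMul (leftMul ι) (X.w T) * b))
    (fun a a' b => by simp only [Subalgebra.coe_add, map_add, add_mul, mul_add])
    (fun c a b => by
      simp only [Subalgebra.coe_smul, map_smul, smul_mul_assoc, smul_eq_mul]
      ring)
    (fun a b b' => by simp only [Subalgebra.coe_add, map_add, mul_add])
    (fun c a b => by
      simp only [Subalgebra.coe_smul, map_smul, mul_smul_comm, smul_eq_mul]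
      ring)

/-- The weak Hopf algebra structure `W` on `A` is the one dual to `B`, with respect to the
pairing: `⟨a₁, b⟩⟨a₂, b'⟩ = ⟨a, bb'⟩`, `ε(a) = ⟨a, 1⟩` and `⟨S_A(a), b⟩ = ⟨a, S(b)⟩`, where the
antipode `S` of `B` is defined by `⟨a, b⟩ = λ⁻² T₂(S(b) e₁ e₂ w a)`. -/
structure IsDualStructure (W : WeakHopfAlgebra k (centA ι)) : Prop where
  comul : ∀ (a : centA ι) (b b' : centB ι),
    LinearMap.mul' k k (TensorProduct.map ((X.pairing T).flip b) ((X.pairing T).flip b')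
      (W.comul a)) = X.pairing T a (b * b')
  counit : ∀ a : centA ι, W.counit a = X.pairing T a 1
  antipode : ∃ S : centB ι ≃ₗ[k] centB ι,
    (∀ (a : centA ι) (b : centB ι), X.pairing T a b =
      X.lam⁻¹ ^ 2 * X.trace₂ T ((S b : EndRight (leftMul ι)) * leftMul (leftMul ι) X.e *
        X.basic.e * leftMul (leftMul ι) (X.w T) * leftMul (leftMul ι) a)) ∧
    ∀ (a : centA ι) (b : centB ι), X.pairing T (W.antipode a) b = X.pairing T a (S b)

end StronglySeparableExt

/-- The element `a₁ m S(a₂)` of `M₁`, for `a ∈ A` and `m ∈ M`. -/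
noncomputable def adjointAct (ι : N →ₐ[k] M) [WeakHopfAlgebra k (centA ι)] (a : centA ι)
    (m : M) : EndRight ι :=
  LinearMap.mul' k (EndRight ι) (TensorProduct.map
    (LinearMap.mulRight k (leftMul ι m) ∘ₗ (centA ι).val.toLinearMap)
    ((centA ι).val.toLinearMap ∘ₗ WeakHopfAlgebra.antipode)
    (Coalgebra.comul (R := k) a))

end JonesTower

/-! An element of A = C_{M₁}(N) is an endomorphism of the N-bimodule M, so A acts on M by evaluation
(`evA`), and everything is computed through this action.

Comultiplication. The guiding rule is a·m = a₁(m)a₂ in M₁. Depth 2 gives dual bases z_i, w_i ∈ A of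
E_M, hence a·m = ∑ E_M(a m z_i) w_i, and each map m ↦ E_M(a m z_i) is again in A. In A ⊗ A the rule
determines Δ(a) only up to balancing over U. A separability element ∑ p_j ⊗ q_j of U repairs this:
the idempotent Δ(1) = ∑ R_{p_j} ⊗ L_{q_j} cuts out a copy of A ⊗_U A on which a ⊗ a' ↦ (m ↦ a(m)a')
is injective (`proj_mul_eq_of_gamma`). Thus Δ(ab) = Δ(a)Δ(b) needs to be checked only in M₁
(`delta_eq`).

Counit and antipode. The element w of the theorem is R_d for a central invertible d ∈ U, and T₀(· d)
has the dual bases p_j, q_j on U. With ā the adjoint of a for the form E(mm'), the structure is ε(a)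
= T₀(a(1)d) and S(a) = R_d⁻¹ ā R_d. The antipode laws come from the reproducing identities of the
dual bases (`anti_mul`, `mul_anti`).

Duality with B. The map b ↦ b(e₁) identifies B with A; it carries the product of B to `star` and the
pairing to T₀(∑ a(x_i)c(y_i)d). By `pair_eq` this form is T₁|_A twisted by bijections, hence
non-degenerate, and by `pair_delta` Δ is dual to `star`. Coassociativity is therefore the
associativity of `star`, and uniqueness is non-degeneracy. That S is dual to S_B rests on T₁(ā) =
T₁(a) (`trace₁_bar`), a consequence of T₁(R_u) = T₀(u), which either alternative of hypothesis 1
yields.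

Smash product. One finds ε_t(a) = L_{a(1)}, so A_t = U, and a₁mS(a₂) = a₁(m)a₂S(a₃) = a₁(m)a₂(1) =
a(m). The rule a·m' = a₁(m')a₂ makes m # a ↦ ma multiplicative, and s ↦ ∑ E_M(s z_i) # w_i is its
inverse. -/

section

variable {k N M : Type*} [Field k] [Ring N] [Ring M] [Algebra k N] [Algebra k M]

/-! ### The algebra A as bimodule endomorphisms of M, with the multiplications by U -/

section Centralizers

variable {ι : N →ₐ[k] M}

theorem mem_cent_iff {j : N →ₐ[k] M} {m : M} : m ∈ cent j ↔ ∀ n, j n * m = m * j n := by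
  simp [cent, Subalgebra.mem_centralizer_iff]

theorem cent_comm (u : cent ι) (n : N) : ι n * u = u * ι n := mem_cent_iff.1 u.2 n

/-- The action of `A = C_{M₁}(N)` on `M`, by endomorphisms of the bimodule `M`. -/
noncomputable def evA : centA ι →ₐ[k] Module.End k M := EndRight.val.comp (centA ι).val

theorem evA_def (a : centA ι) (m : M) : evA a m = (a : EndRight ι).val m := rfl

@[simp] theorem evA_one (m : M) : evA (1 : centA ι) m = m := by simp

@[simp] theorem evA_mul (a b : centA ι) (m : M) : evA (a * b) m = evA a (evA b m) := by simp

theorem centA_ext {a b : centA ι} (h : ∀ m, evA a m = evA b m) : a = b :=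
  Subtype.ext (EndRight.ext h)

theorem evA_right (a : centA ι) (m : M) (n : N) : evA a (m * ι n) = evA a m * ι n :=
  EndRight.val_apply_mul _ _ _

theorem evA_left (a : centA ι) (n : N) (m : M) : evA a (ι n * m) = ι n * evA a m := by
  have h := mem_cent_iff.1 a.2 n
  exact (congrArg (fun f : EndRight ι => f.val m) h).symm

/-- The element of `A` given by an endomorphism of the bimodule `M`. -/
def centA.mk (f : M →ₗ[k] M) (hl : ∀ n m, f (ι n * m) = ι n * f m)
    (hr : ∀ m n, f (m * ι n) = f m * ι n) : centA ι :=
  ⟨⟨f, hr⟩, mem_cent_iff.2 fun n => EndRight.ext fun m => (hl n m).symm⟩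

@[simp] theorem evA_mk (f : M →ₗ[k] M) (hl : ∀ n m, f (ι n * m) = ι n * f m)
    (hr : ∀ m n, f (m * ι n) = f m * ι n) (m : M) : evA (centA.mk f hl hr) m = f m := rfl

theorem evA_one_mem (a : centA ι) (u : cent ι) : evA a (u : M) ∈ cent ι :=
  mem_cent_iff.2 fun n => by rw [← evA_left, ← evA_right, cent_comm]

/-- The action of `A` on `U`. -/
noncomputable def actU (a : centA ι) : cent ι →ₗ[k] cent ι where
  toFun u := ⟨evA a u, evA_one_mem a u⟩
  map_add' u v := Subtype.ext (by simp)
  map_smul' c u := Subtype.ext (by simp)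

@[simp] theorem coe_actU (a : centA ι) (u : cent ι) : (actU a u : M) = evA a u := rfl

/-- Left multiplication by an element of `U`, as an element of `A`. -/
noncomputable def lA : cent ι →ₗ[k] centA ι where
  toFun u := centA.mk (LinearMap.mulLeft k u)
    (fun n m => by simp only [LinearMap.mulLeft_apply, ← mul_assoc, cent_comm])
    (fun m n => by simp [mul_assoc])
  map_add' u v := centA_ext fun m => by simp [add_mul]; rfl
  map_smul' c u := centA_ext fun m => by simp; rfl

/-- Right multiplication by an element of `U`, as an element of `A`. -/
noncomputable def rA : cent ι →ₗ[k] centA ι where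
  toFun u := centA.mk (LinearMap.mulRight k u)
    (fun n m => by simp [mul_assoc])
    (fun m n => by simp only [LinearMap.mulRight_apply, mul_assoc, cent_comm])
  map_add' u v := centA_ext fun m => by simp [mul_add]; rfl
  map_smul' c u := centA_ext fun m => by simp; rfl

@[simp] theorem evA_lA (u : cent ι) (m : M) : evA (lA u) m = u * m := rfl

@[simp] theorem evA_rA (u : cent ι) (m : M) : evA (rA u) m = m * u := rfl

theorem coe_lA (u : cent ι) : (lA u : EndRight ι) = leftMul ι u := rfl

theorem lA_one : lA (1 : cent ι) = 1 := centA_ext fun m => by simp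

theorem rA_one : rA (1 : cent ι) = 1 := centA_ext fun m => by simp

theorem lA_mul (u v : cent ι) : lA (u * v) = lA u * lA v :=
  centA_ext fun m => by simp [mul_assoc]

theorem rA_mul (u v : cent ι) : rA (u * v) = rA v * rA u :=
  centA_ext fun m => by simp [mul_assoc]

theorem lA_rA_comm (u v : cent ι) : lA u * rA v = rA v * lA u :=
  centA_ext fun m => by simp [mul_assoc]

theorem rA_leftMul_comm (u : cent ι) (m : M) :
    (rA u : EndRight ι) * leftMul ι m = leftMul ι m * rA u :=
  EndRight.ext fun m' => by
    change m * m' * u = m * (m' * u)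
    rw [mul_assoc]

end Centralizers

namespace StronglySeparableExt

variable {ι : N →ₐ[k] M} (X : StronglySeparableExt ι) (T : N →ₗ[k] k)

/-! ### Traces along the tower -/

section Markov

variable {X T}

theorem basic_E_apply (f : EndRight ι) :
    X.basic.E f = X.lam • ∑ i, f.val (X.x i) * X.y i := X.condExp_apply f

theorem trace₀_apply (m : M) : X.trace₀ T m = T (X.E m) := rfl

theorem trace₁_apply (f : EndRight ι) : X.trace₁ T f = X.trace₀ T (X.basic.E f) := rfl

theorem IsMarkovTrace.trace₀_comm (hT : X.IsMarkovTrace T) (m m' : M) :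
    X.trace₀ T (m * m') = X.trace₀ T (m' * m) := hT.2.2 m m'

/-- Expanding f in the dual bases writes T₁(fg) through the matrix coefficients E(y_i f(x_j)) and
E(y_j g(x_i)) in N, like the trace of a product of matrices; that T₁ is a trace thus reduces to T
being one. -/
theorem trace₁_mul_eq (hT : X.IsMarkovTrace T) (f g : EndRight ι) : X.trace₁ T (f * g) =
    X.lam * ∑ i, ∑ j, T (X.E (X.y i * f.val (X.x j)) * X.E (X.y j * g.val (X.x i))) := by
  rw [trace₁_apply, basic_E_apply, map_smul, smul_eq_mul, map_sum]
  congr 1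
  refine Finset.sum_congr rfl fun i _ => ?_
  rw [EndRight.val_mul_apply, X.apply_eq_sum f, hT.trace₀_comm, Finset.mul_sum, map_sum]
  refine Finset.sum_congr rfl fun j _ => ?_
  rw [trace₀_apply, ← mul_assoc, X.E_right]

/-- The trace `T ∘ E` is a Markov trace for the basic construction. -/
theorem IsMarkovTrace.basic (hT : X.IsMarkovTrace T) : X.basic.IsMarkovTrace (X.trace₀ T) := by
  refine ⟨hT.2.2, ?_, fun f g => ?_⟩
  · rw [trace₀_apply, X.E_one, hT.2.1]
  · have h := trace₁_mul_eq hT g f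
    -- After exchanging the sums, the formulas for T₁(fg) and T₁(gf) differ only by commuting two
    -- factors of N under T.
    rw [Finset.sum_comm] at h
    refine (trace₁_mul_eq hT f g).trans (Eq.trans ?_ h.symm)
    congr 1
    exact Finset.sum_congr rfl fun i _ => Finset.sum_congr rfl fun j _ => hT.1 _ _

theorem IsMarkovTrace.trace₁_comm (hT : X.IsMarkovTrace T) (f g : EndRight ι) :
    X.trace₁ T (f * g) = X.trace₁ T (g * f) := hT.basic.trace₀_comm f g

theorem IsMarkovTrace.trace₂_comm (hT : X.IsMarkovTrace T) (f g : EndRight (leftMul ι)) :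
    X.trace₂ T (f * g) = X.trace₂ T (g * f) := hT.basic.basic.trace₀_comm f g

/-- `E_M(f e₁) = λ f(1)` -/
theorem basic_E_mul_e (f : EndRight ι) : X.basic.E (f * X.e) = X.lam • f.val 1 := by
  rw [basic_E_apply]
  have h : ∀ m, f.val (ι (X.E m)) = f.val 1 * ι (X.E m) := fun m => by
    rw [← f.val_apply_mul, one_mul]
  simp only [EndRight.val_mul_apply, e_apply, h, mul_assoc, ← Finset.mul_sum]
  have h1 := X.dual_left 1
  simp only [one_mul] at h1
  rw [h1, mul_one]

end Markov

/-! ### The Casimir element ∑ x_i ⊗ y_i -/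

section Casimir

variable {G : Type*} [AddCommGroup G]

/-- `∑ m x_i ⊗ y_i = ∑ x_i ⊗ y_i m`, evaluated at an `N`-balanced map. -/
theorem sum_casimir (F : M → M → G) (m : M)
    (h₁ : ∀ (s : Fin X.r → M) b, F (∑ i, s i) b = ∑ i, F (s i) b)
    (h₂ : ∀ (s : Fin X.r → M) a, F a (∑ i, s i) = ∑ i, F a (s i))
    (hF : ∀ a n b, F (a * ι n) b = F a (ι n * b)) :
    ∑ i, F (m * X.x i) (X.y i) = ∑ i, F (X.x i) (X.y i * m) := by
  calc ∑ i, F (m * X.x i) (X.y i)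
      = ∑ i, ∑ j, F (X.x j) (ι (X.E (X.y j * (m * X.x i))) * X.y i) :=
        Finset.sum_congr rfl fun i _ => by
          conv_lhs => rw [← X.dual_right (m * X.x i), h₁]
          exact Finset.sum_congr rfl fun j _ => hF _ _ _
    _ = _ := by
        rw [Finset.sum_comm]
        refine Finset.sum_congr rfl fun j _ => ?_
        rw [← h₂]
        congr 1
        simp only [← mul_assoc]
        exact X.dual_left _

end Casimir

/-! ### Adjoints with respect to the form E(mm') -/

section Bar

/-- The map `ā`, with `E(m a(m')) = E(ā(m) m')`. -/
noncomputable def bar : centA ι →ₗ[k] centA ι where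
  toFun a := centA.mk
    { toFun := fun m => ∑ i, ι (X.E (m * evA a (X.x i))) * X.y i
      map_add' := fun m m' => by simp [add_mul, Finset.sum_add_distrib]
      map_smul' := fun c m => by simp [Finset.smul_sum] }
    (fun n m => by simp [mul_assoc, X.E_left, Finset.mul_sum])
    (fun m n => by
      simp only [LinearMap.coe_mk, AddHom.coe_mk, mul_assoc, Finset.sum_mul, ← evA_left]
      -- Right N-linearity holds because n commutes with the Casimir element; the map is balanced
      -- since a is right N-linear.
      exact X.sum_casimir (fun p q => ι (X.E (m * evA a p)) * q) (ι n)
        (fun s b => by simp [Finset.mul_sum, Finset.sum_mul]) (fun s b => by simp [Finset.mul_sum])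
        (fun p n q => by simp [evA_right, ← mul_assoc, X.E_right]))
  map_add' a b := centA_ext fun m => by simp [mul_add, add_mul, Finset.sum_add_distrib]
  map_smul' c a := centA_ext fun m => by simp [Finset.smul_sum]

theorem evA_bar (a : centA ι) (m : M) :
    evA (X.bar a) m = ∑ i, ι (X.E (m * evA a (X.x i))) * X.y i := rfl

/-- The inverse of `a ↦ ā`. -/
noncomputable def und : centA ι →ₗ[k] centA ι where
  toFun a := centA.mk
    { toFun := fun m => ∑ i, X.x i * ι (X.E (evA a (X.y i) * m))
      map_add' := fun m m' => by simp [mul_add, Finset.sum_add_distrib]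
      map_smul' := fun c m => by simp [Finset.smul_sum] }
    (fun n m => by
      simp only [LinearMap.coe_mk, AddHom.coe_mk, ← mul_assoc, Finset.mul_sum, ← evA_right]
      exact (X.sum_casimir (fun p q => p * ι (X.E (evA a q * m))) (ι n)
        (fun s b => by simp [Finset.sum_mul])
        (fun s b => by simp [Finset.mul_sum, Finset.sum_mul])
        (fun p n q => by simp [evA_left, mul_assoc, X.E_left])).symm)
    (fun m n => by simp [← mul_assoc, X.E_right, Finset.sum_mul])
  map_add' a b := centA_ext fun m => by simp [mul_add, add_mul, Finset.sum_add_distrib]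
  map_smul' c a := centA_ext fun m => by simp [Finset.smul_sum]

theorem evA_und (a : centA ι) (m : M) :
    evA (X.und a) m = ∑ i, X.x i * ι (X.E (evA a (X.y i) * m)) := rfl

/-- Expanding m' = ∑ x_i E(y_i m') pulls the coefficients in N out of a and out of E, which leaves
the defining sum of ā(m). -/
theorem E_bar (a : centA ι) (m m' : M) : X.E (m * evA a m') = X.E (evA (X.bar a) m * m') := by
  conv_lhs => rw [← X.dual_right m', map_sum, Finset.mul_sum, map_sum]
  simp only [evA_bar, Finset.sum_mul, map_sum, mul_assoc, X.E_left, evA_right]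
  simp only [← mul_assoc, X.E_right]

theorem E_und (a : centA ι) (m m' : M) : X.E (evA a m * m') = X.E (m * evA (X.und a) m') := by
  conv_lhs => rw [← X.dual_left m, map_sum, Finset.sum_mul, map_sum]
  simp only [evA_und, Finset.mul_sum, map_sum, evA_left, mul_assoc, X.E_left]
  simp only [← mul_assoc, X.E_right]

/-- The form E(mm') is non-degenerate because it has dual bases; this makes adjoints unique. -/
theorem eq_of_E_mul_left {m m' : M} (h : ∀ c, X.E (c * m) = X.E (c * m')) : m = m' := by
  rw [← X.dual_right m, ← X.dual_right m']
  simp only [h]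

theorem eq_of_E_mul_right {m m' : M} (h : ∀ c, X.E (m * c) = X.E (m' * c)) : m = m' := by
  rw [← X.dual_left m, ← X.dual_left m']
  simp only [h]

@[simp] theorem bar_und (a : centA ι) : X.bar (X.und a) = a :=
  centA_ext fun m => X.eq_of_E_mul_right fun c => by rw [← E_bar, ← E_und]

@[simp] theorem und_bar (a : centA ι) : X.und (X.bar a) = a :=
  centA_ext fun m => X.eq_of_E_mul_left fun c => by rw [← E_und, ← E_bar]

theorem bar_mul (a b : centA ι) : X.bar (a * b) = X.bar b * X.bar a :=
  centA_ext fun m => X.eq_of_E_mul_right fun c => by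
    rw [← E_bar, evA_mul, evA_mul, E_bar, E_bar]

theorem bar_lA (u : cent ι) : X.bar (lA u) = rA u :=
  centA_ext fun m => X.eq_of_E_mul_right fun c => by
    rw [← E_bar]; simp [mul_assoc]

variable {X}

/-- This is where the symmetry E(um) = E(mu) enters. It makes the adjoint exchange L_u and R_u in
both directions, so that under S the two legs of Δ(1) can meet. -/
theorem bar_rA (hX : X.IsSymmetric) (u : cent ι) : X.bar (rA u) = lA u :=
  centA_ext fun m => X.eq_of_E_mul_right fun c => by
    rw [← E_bar, evA_rA, evA_lA, ← mul_assoc, ← hX u u.2, mul_assoc]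

end Bar

/-- The map `E_M(a · b)`, as an element of `A`. -/
noncomputable def cross : centA ι →ₗ[k] centA ι →ₗ[k] centA ι :=
  LinearMap.mk₂ k (fun a b => centA.mk (X.basic.E ∘ₗ
      LinearMap.mulLeft k (a : EndRight ι) ∘ₗ LinearMap.mulRight k (b : EndRight ι) ∘ₗ (leftMul ι).toLinearMap)
    (fun n m => by
      have h := mem_cent_iff.1 a.2 n
      simp only [AlgHom.comp_apply] at h
      simp only [LinearMap.comp_apply, LinearMap.mulLeft_apply, LinearMap.mulRight_apply, AlgHom.toLinearMap_apply,
        map_mul, ← mul_assoc, ← h]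
      simp only [mul_assoc, X.basic.E_left])
    (fun m n => by
      have h := mem_cent_iff.1 b.2 n
      simp only [AlgHom.comp_apply] at h
      simp only [LinearMap.comp_apply, LinearMap.mulLeft_apply, LinearMap.mulRight_apply, AlgHom.toLinearMap_apply,
        map_mul, mul_assoc, h]
      simp only [← mul_assoc, X.basic.E_right]))
    (fun a a' b => centA_ext fun m => by simp [add_mul])
    (fun c a b => centA_ext fun m => by simp)
    (fun a b b' => centA_ext fun m => by simp [mul_add])
    (fun c a b => centA_ext fun m => by simp)

theorem evA_cross (a b : centA ι) (m : M) :
    evA (X.cross a b) m = X.basic.E ((a : EndRight ι) * leftMul ι m * b) := by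
  rw [mul_assoc]; rfl

end StronglySeparableExt

/-! ### The depth 2 data and the dual bases of T₁ on A -/

namespace StronglySeparableExt

variable {ι : N →ₐ[k] M} (X : StronglySeparableExt ι) (T : N →ₗ[k] k)

/-- Dual bases of `E_M` in `A` and a symmetric separability element `∑ p_j ⊗ q_j` of `U`, for
which `T₀` has the dual bases `p_j`, `q_j d` with `d` central and invertible. -/
structure DepthTwoData where
  markov : X.IsMarkovTrace T
  symm : X.IsSymmetric
  trace_rA : ∀ u : cent ι, X.trace₁ T (rA u : centA ι) = X.trace₀ T u
  n : ℕ
  z : Fin n → centA ι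
  w : Fin n → centA ι
  dual_left : ∀ s : EndRight ι, ∑ i, leftMul ι (X.basic.E (s * z i)) * (w i : EndRight ι) = s
  dual_right : ∀ s : EndRight ι, ∑ i, (z i : EndRight ι) * leftMul ι (X.basic.E (w i * s)) = s
  m : ℕ
  p : Fin m → cent ι
  q : Fin m → cent ι
  sum_mul : ∑ j, p j * q j = 1
  sum_comm : ∀ u : cent ι, ∑ j, (u * p j) ⊗ₜ[k] q j = ∑ j, p j ⊗ₜ[k] (q j * u)
  d : cent ι
  d' : cent ι
  d_mul : d * d' = 1
  d_comm : ∀ u, d * u = u * d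
  sum_p : ∀ u : cent ι, ∑ j, X.trace₀ T (q j * u * d : cent ι) • p j = u
  sum_q : ∀ u : cent ι, ∑ j, X.trace₀ T (p j * u * d : cent ι) • q j = u

variable {X T}

theorem trace₀_bar (a : centA ι) (m m' : M) :
    X.trace₀ T (m * evA a m') = X.trace₀ T (evA (X.bar a) m * m') := by
  rw [trace₀_apply, X.E_bar]; rfl

variable (X) in
/-- The Jones idempotent as an element of `A`. -/
def eA : centA ι := centA.mk (ι.toLinearMap ∘ₗ X.E) (fun n m => by simp [X.E_left])
  (fun m n => by simp [X.E_right])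

theorem coe_eA : ((X.eA : centA ι) : EndRight ι) = X.e := rfl

@[simp] theorem evA_eA (m : M) : evA X.eA m = ι (X.E m) := rfl

variable (X) in
/-- The restriction `A → U` of `E_M`. -/
noncomputable def EU : centA ι →ₗ[k] cent ι where
  toFun a := ⟨X.basic.E a, by
    have h := evA_one_mem (X.cross a 1) (1 : cent ι)
    simpa [evA_cross] using h⟩
  map_add' a b := Subtype.ext (by simp)
  map_smul' c a := Subtype.ext (by simp)

@[simp] theorem coe_EU (a : centA ι) : (X.EU a : M) = X.basic.E a := rfl

theorem EU_mul_lA (a : centA ι) (u : cent ι) : X.EU (a * lA u) = X.EU a * u :=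
  Subtype.ext (X.basic.E_right _ _)

/-- `E_M(e₁ a) = λ ā(1)` for `a ∈ A` -/
theorem basic_E_e_mul (a : centA ι) (m : M) :
    X.basic.E (X.e * leftMul ι m * a) = X.lam • evA (X.bar a) m := by
  rw [basic_E_apply]
  rfl

theorem basic_E_mul_e_mul' (f : EndRight ι) (m : M) :
    X.basic.E (f * leftMul ι m * X.e) = X.lam • f.val m := by
  rw [basic_E_mul_e, EndRight.val_mul_apply, leftMul_apply, mul_one]

namespace DepthTwoData

variable (D : X.DepthTwoData T)

theorem trace₁_comm (D : X.DepthTwoData T) (a b : centA ι) :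
    X.trace₁ T (a * b : centA ι) = X.trace₁ T (b * a : centA ι) := D.markov.trace₁_comm _ _

theorem d'_mul : D.d' * D.d = 1 := by rw [← D.d_comm, D.d_mul]

theorem d'_comm (u : cent ι) : D.d' * u = u * D.d' := by
  calc D.d' * u = D.d' * (u * D.d) * D.d' := by rw [mul_assoc, mul_assoc, D.d_mul, mul_one]
    _ = u * D.d' := by rw [← D.d_comm, ← mul_assoc, D.d'_mul, one_mul]

/-- E_M maps A into U, so its dual bases in A are also dual bases of A over U. -/
theorem sum_EU (a : centA ι) : ∑ i, lA (X.EU (a * D.z i)) * D.w i = a :=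
  Subtype.ext (by
    rw [AddSubmonoidClass.coe_finsetSum]
    exact D.dual_left a)

theorem trace₁_mul_lA (a : centA ι) (u : cent ι) :
    X.trace₁ T (a * lA u : centA ι) = X.trace₀ T (X.EU a * u : cent ι) := by
  rw [← EU_mul_lA]; rfl

theorem sum_q' (u : cent ι) : ∑ j, X.trace₀ T (u * D.p j : cent ι) • (D.q j * D.d) = u := by
  have h := congrArg (· * D.d) (D.sum_q (u * D.d'))
  simp only [mul_assoc, D.d'_mul, mul_one, Finset.sum_mul, smul_mul_assoc] at h
  convert h using 3 with j
  exact D.markov.trace₀_comm _ _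

/-- The first half of the dual bases of `T₁|_A`. -/
noncomputable def Q₁ (s : Fin D.n × Fin D.m) : centA ι := D.z s.1 * lA (D.p s.2)

/-- The second half of the dual bases of `T₁|_A`. -/
noncomputable def Q₂ (s : Fin D.n × Fin D.m) : centA ι := lA (D.q s.2 * D.d) * D.w s.1

/-- Dual bases compose: z_i, w_i for A over U, followed by p_j, q_j d for T₀|_U, give dual bases of
T₁|_A. -/
theorem sum_Q (a : centA ι) : ∑ s, X.trace₁ T (a * D.Q₁ s : centA ι) • D.Q₂ s = a := by
  rw [Fintype.sum_prod_type]
  conv_rhs => rw [← D.sum_EU a]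
  refine Finset.sum_congr rfl fun i _ => ?_
  conv_rhs => rw [← D.sum_q' (X.EU (a * D.z i)), map_sum, Finset.sum_mul]
  simp only [Q₁, Q₂, ← mul_assoc, trace₁_mul_lA, smul_mul_assoc, map_smul]

theorem eq_zero_of_trace₁ (D : X.DepthTwoData T) {a : centA ι} (h : ∀ b : centA ι, X.trace₁ T (a * b : centA ι) = 0) :
    a = 0 := by
  rw [← D.sum_Q a]
  simp only [h, zero_smul, Finset.sum_const_zero]

theorem eq_of_trace₁ (D : X.DepthTwoData T) {a a' : centA ι}
    (h : ∀ b : centA ι, X.trace₁ T (a * b : centA ι) = X.trace₁ T (a' * b : centA ι)) :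
    a = a' :=
  sub_eq_zero.1 <| D.eq_zero_of_trace₁ fun b => by
    rw [sub_mul, Subalgebra.coe_sub, map_sub, h, sub_self]

/-- By non-degeneracy it suffices to apply T₁(· b); the trace property then turns the sum into the
expansion of b by `sum_Q`. -/
theorem sum_Q' (a : centA ι) : ∑ s, X.trace₁ T (a * D.Q₂ s : centA ι) • D.Q₁ s = a := by
  refine D.eq_of_trace₁ fun b => ?_
  conv_rhs => rw [D.trace₁_comm, ← D.sum_Q b]
  simp only [Finset.sum_mul, smul_mul_assoc, AddSubmonoidClass.coe_finsetSum, Subalgebra.coe_smul,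
    map_sum, map_smul, smul_eq_mul]
  refine Finset.sum_congr rfl fun s _ => ?_
  rw [mul_comm, D.trace₁_comm a, D.trace₁_comm b]

/-- The restriction of `T₁` to `A`. -/
noncomputable def tr (X : StronglySeparableExt ι) (T : N →ₗ[k] k) : centA ι →ₗ[k] k :=
  X.trace₁ T ∘ₗ (centA ι).val.toLinearMap

theorem tr_apply (a : centA ι) : tr X T a = X.trace₁ T (a : EndRight ι) := rfl

/-- The functionals `T₁(· c)` separate the elements of `A ⊗ G`. -/
theorem tensor_eq_zero (D : X.DepthTwoData T) {G : Type*} [AddCommGroup G] [Module k G] {t : centA ι ⊗[k] G}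
    (h : ∀ c, (tr X T ∘ₗ LinearMap.mulRight k c).rTensor G t = 0) : t = 0 := by
  have key : ∀ t : centA ι ⊗[k] G, t = ∑ s, D.Q₂ s ⊗ₜ[k] TensorProduct.lid k G
      ((tr X T ∘ₗ LinearMap.mulRight k (D.Q₁ s)).rTensor G t) := by
    intro t
    induction t with
    | zero => simp
    | add a b ha hb =>
      simp only [map_add, TensorProduct.tmul_add, Finset.sum_add_distrib, ← ha, ← hb]
    | tmul a g =>
      conv_lhs => rw [← D.sum_Q a, TensorProduct.sum_tmul]
      simp [tr_apply, TensorProduct.smul_tmul]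
  rw [key t]
  simp [h]

/-- The dual basis tensor of a non-degenerate trace is symmetric: both sides have the same
contractions with the functionals T₁(· c), which separate tensors. -/
theorem sum_Q_symm : ∑ s, D.Q₁ s ⊗ₜ[k] D.Q₂ s = ∑ s, D.Q₂ s ⊗ₜ[k] D.Q₁ s := by
  refine sub_eq_zero.1 (D.tensor_eq_zero fun c => ?_)
  apply (TensorProduct.lid k (centA ι)).injective
  simp only [map_sub, map_sum, LinearMap.rTensor_tmul, TensorProduct.lid_tmul, map_zero,
    LinearMap.comp_apply, LinearMap.mulRight_apply, tr_apply, D.trace₁_comm _ c, sum_Q, sum_Q',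
    sub_self]

theorem trace₁_eq_sum (a b : centA ι) : X.trace₁ T (a * b : centA ι) =
    X.lam * ∑ i, X.trace₀ T (evA a (evA b (X.x i)) * X.y i) := by
  rw [trace₁_apply, basic_E_apply, map_smul, map_sum, smul_eq_mul]
  rfl

/-- T₀ is assumed non-degenerate only on U, not on M. Still, its matrix elements T₀(a(m)m')
determine all T₁(ac), and T₁ is non-degenerate on A. -/
theorem centA_eq_of_trace₀ (D : X.DepthTwoData T) {a b : centA ι}
    (h : ∀ m m', X.trace₀ T (evA a m * m') = X.trace₀ T (evA b m * m')) : a = b :=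
  D.eq_of_trace₁ fun c => by simp only [trace₁_eq_sum, h]

theorem trace₀_cross (a b : centA ι) (m m' : M) : X.trace₀ T (m' * evA (X.cross a b) m) =
    X.trace₁ T (leftMul ι m' * a * leftMul ι m * b) := by
  rw [evA_cross, ← X.basic.E_left, trace₁_apply]
  simp only [mul_assoc]

/-- The matrix elements of both sides are values of T₁ on the same four factors in cyclically
permuted order. -/
theorem bar_cross (D : X.DepthTwoData T) (a b : centA ι) : X.bar (X.cross a b) = X.cross b a :=
  D.centA_eq_of_trace₀ fun m m' => by
    rw [← trace₀_bar, trace₀_cross, D.markov.trace₀_comm, trace₀_cross,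
      mul_assoc (_ * _), D.markov.trace₁_comm]
    simp only [mul_assoc]

end DepthTwoData
end StronglySeparableExt

/-! ### The comultiplication, from a·m = a₁(m)a₂ -/

namespace StronglySeparableExt

variable {ι : N →ₐ[k] M} {X : StronglySeparableExt ι} {T : N →ₗ[k] k}

/-- The map `a ⊗ a' ↦ (m ↦ a(m) a')` from `A ⊗ A` to maps from `M` to `M₁`. -/
noncomputable def gamma : centA ι ⊗[k] centA ι →ₗ[k] M →ₗ[k] EndRight ι :=
  TensorProduct.lift (LinearMap.mk₂ k
    (fun a b => LinearMap.mulRight k (b : EndRight ι) ∘ₗ (leftMul ι).toLinearMap ∘ₗ evA a)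
    (fun a a' b => LinearMap.ext fun m => by simp [add_mul])
    (fun c a b => LinearMap.ext fun m => by simp)
    (fun a b b' => LinearMap.ext fun m => by simp [mul_add])
    (fun c a b => LinearMap.ext fun m => by simp))

@[simp] theorem gamma_tmul (a b : centA ι) (m : M) :
    gamma (a ⊗ₜ[k] b) m = leftMul ι (evA a m) * b := rfl

namespace DepthTwoData

variable (D : X.DepthTwoData T)

/-- The idempotent `∑ R_{p_j} ⊗ L_{q_j}`, which will be `Δ(1)`. -/
noncomputable def proj : centA ι ⊗[k] centA ι := ∑ j, rA (D.p j) ⊗ₜ[k] lA (D.q j)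

theorem coe_sum_mul : ∑ j, (D.p j : M) * D.q j = 1 := by
  have h := congrArg (Subtype.val) D.sum_mul
  simpa using h

/-- The two legs of Δ(1) meet inside M₁ as p_j q_j, and ∑ p_j q_j = 1. -/
theorem gamma_proj_mul (t : centA ι ⊗[k] centA ι) : gamma (D.proj * t) = gamma t := by
  ext1 m
  induction t with
  | zero => simp
  | add a b ha hb => simp only [mul_add, map_add, LinearMap.add_apply, ha, hb]
  | tmul a b =>
    simp only [proj, Finset.sum_mul, Algebra.TensorProduct.tmul_mul_tmul, map_sum,
      LinearMap.sum_apply, gamma_tmul, evA_mul, evA_rA, Subalgebra.coe_mul, coe_lA, ← mul_assoc,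
      ← map_mul]
    rw [← Finset.sum_mul, ← map_sum]
    simp only [mul_assoc (evA a m), ← Finset.mul_sum]
    rw [coe_sum_mul, mul_one]

/-- The separability property u p_j ⊗ q_j = p_j ⊗ q_j u becomes U-balancing: multiplication by
`D.proj` is a projection of A ⊗ A that factors through A ⊗_U A. -/
theorem proj_mul_tmul (u : cent ι) (a b : centA ι) :
    D.proj * ((rA u * a) ⊗ₜ[k] b) = D.proj * (a ⊗ₜ[k] (lA u * b)) := by
  have h := congrArg (TensorProduct.map rA lA) (D.sum_comm u)
  simp only [map_sum, TensorProduct.map_tmul, rA_mul, lA_mul] at h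
  have e : D.proj * (rA u ⊗ₜ[k] 1) = D.proj * (1 ⊗ₜ[k] lA u) := by
    simpa [proj, Finset.sum_mul] using h
  calc D.proj * ((rA u * a) ⊗ₜ[k] b) = D.proj * (rA u ⊗ₜ[k] 1) * (a ⊗ₜ[k] b) := by
        rw [mul_assoc]; simp
    _ = _ := by rw [e, mul_assoc]; simp

/-- Balancing moves R_{p_j} of the second factor into the second leg as L_{p_j}, where ∑ p_j q_j =
1. -/
theorem proj_mul_proj : D.proj * D.proj = D.proj := by
  conv_lhs => rw [proj.eq_1 D]
  change D.proj * _ = _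
  rw [Finset.mul_sum]
  have h : ∀ j, D.proj * (rA (D.p j) ⊗ₜ[k] lA (D.q j)) =
      D.proj * ((1 : centA ι) ⊗ₜ[k] lA (D.p j * D.q j)) := fun j => by
    have := D.proj_mul_tmul (D.p j) 1 (lA (D.q j))
    rwa [mul_one, ← lA_mul] at this
  simp only [h]
  rw [← Finset.mul_sum, ← TensorProduct.tmul_sum, ← map_sum, D.sum_mul, lA_one,
    ← Algebra.TensorProduct.one_def, mul_one]

theorem cross_mul_lA (a b : centA ι) (u : cent ι) : X.cross a (b * lA u) = rA u * X.cross a b :=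
  centA_ext fun m => by
    simp only [evA_cross, evA_mul, evA_rA, Subalgebra.coe_mul, coe_lA, ← mul_assoc,
      X.basic.E_right]

/-- An element of `Δ(1)(A ⊗ A)` is determined by its image under `gamma`. -/
theorem proj_mul_eq_of_gamma {s t : centA ι ⊗[k] centA ι} (h : ∀ m, gamma s m = gamma t m) :
    D.proj * s = D.proj * t := by
  -- Normal form: modulo `D.proj` every tensor is ∑ g_i ⊗ w_i, with coefficients g_i(m) = E_M(gamma
  -- t m · z_i) that depend only on the image under `gamma`.
  have key : ∀ t : centA ι ⊗[k] centA ι, ∃ g : Fin D.n → centA ι,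
      (∀ i m, evA (g i) m = X.basic.E (gamma t m * D.z i)) ∧
      D.proj * t = D.proj * ∑ i, g i ⊗ₜ[k] D.w i := by
    intro t
    induction t with
    | zero => exact ⟨0, by simp, by simp⟩
    | add a b ha hb =>
      obtain ⟨g, hg, hg'⟩ := ha
      obtain ⟨f, hf, hf'⟩ := hb
      refine ⟨g + f, fun i m => ?_, ?_⟩
      · simp [hg, hf, add_mul]
      · simp only [mul_add, hg', hf', Pi.add_apply, TensorProduct.add_tmul,
          Finset.sum_add_distrib]
    | tmul a b =>
      refine ⟨fun i => rA (X.EU (b * D.z i)) * a, fun i m => ?_, ?_⟩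
      · simp [mul_assoc, X.basic.E_left]
      · simp only [Finset.mul_sum, proj_mul_tmul]
        rw [← Finset.mul_sum, ← TensorProduct.tmul_sum, sum_EU]
  obtain ⟨g, hg, hg'⟩ := key s
  obtain ⟨f, hf, hf'⟩ := key t
  have e : g = f := funext fun i => centA_ext fun m => by rw [hg, hf, h]
  rw [hg', hf', e]

/-- The comultiplication of `A`. -/
noncomputable def delta : centA ι →ₗ[k] centA ι ⊗[k] centA ι :=
  LinearMap.mulLeft k D.proj ∘ₗ
    ∑ i, (TensorProduct.mk k (centA ι) (centA ι)).flip (D.w i) ∘ₗ X.cross.flip (D.z i)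

theorem delta_apply (a : centA ι) :
    D.delta a = D.proj * ∑ i, X.cross a (D.z i) ⊗ₜ[k] D.w i := by
  simp [delta, Finset.mul_sum]

theorem proj_mul_delta (a : centA ι) : D.proj * D.delta a = D.delta a := by
  rw [delta_apply, ← mul_assoc, proj_mul_proj]

/-- `a m = a₁(m) a₂` in `M₁` -/
theorem gamma_delta (a : centA ι) (m : M) :
    gamma (D.delta a) m = (a : EndRight ι) * leftMul ι m := by
  rw [delta_apply, gamma_proj_mul]
  simp only [map_sum, LinearMap.sum_apply, gamma_tmul, evA_cross]
  exact D.dual_left _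

/-- The working characterization of Δ, from injectivity of `gamma` on the image of `D.proj`:
identities for Δ are verified in M₁. -/
theorem delta_eq {a : centA ι} {t : centA ι ⊗[k] centA ι} (ht : D.proj * t = t)
    (h : ∀ m, gamma t m = (a : EndRight ι) * leftMul ι m) : D.delta a = t := by
  rw [← proj_mul_delta, ← ht]
  exact D.proj_mul_eq_of_gamma fun m => by rw [gamma_delta, h]

theorem delta_one : D.delta 1 = D.proj := by
  refine D.delta_eq D.proj_mul_proj fun m => ?_
  rw [← mul_one D.proj, gamma_proj_mul]
  simp [Algebra.TensorProduct.one_def]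

/-- In M₁ one has a b m = a b₁(m) b₂ = a₁(b₁(m)) a₂ b₂. -/
theorem delta_mul (a b : centA ι) : D.delta (a * b) = D.delta a * D.delta b := by
  refine D.delta_eq (by rw [← mul_assoc, proj_mul_delta]) fun m => ?_
  have key : ∀ s t : centA ι ⊗[k] centA ι, (∀ m, gamma s m = (a : EndRight ι) * leftMul ι m) →
      gamma (s * t) m = (a : EndRight ι) * gamma t m := by
    intro s t hs
    induction t with
    | zero => simp
    | add c d hc hd => simp only [mul_add, map_add, LinearMap.add_apply, hc, hd]
    | tmul c d =>
      rw [gamma_tmul, ← mul_assoc, ← hs]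
      clear hs
      induction s with
      | zero => simp
      | add c d hc hd => simp only [add_mul, map_add, LinearMap.add_apply, hc, hd]
      | tmul e f => simp [mul_assoc]
  rw [key _ _ (D.gamma_delta a), gamma_delta, Subalgebra.coe_mul, mul_assoc]

/-- R_u commutes with left multiplications, so R_u m = m R_u in M₁ and the first leg acts trivially
on m. -/
theorem delta_rA (u : cent ι) : D.delta (rA u) = D.proj * (1 ⊗ₜ[k] rA u) := by
  refine D.delta_eq (by rw [← mul_assoc, proj_mul_proj]) fun m => ?_
  rw [gamma_proj_mul, gamma_tmul, rA_leftMul_comm, evA_one]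

/-! ### The counit and the weak bialgebra axioms -/

/-- The counit `ε(a) = T₀(a(1) w)`. -/
noncomputable def eps : centA ι →ₗ[k] k :=
  X.trace₀ T ∘ₗ LinearMap.mulRight k (D.d : M) ∘ₗ LinearMap.applyₗ (1 : M) ∘ₗ evA.toLinearMap

theorem eps_apply (a : centA ι) : D.eps a = X.trace₀ T (evA a 1 * D.d) := rfl

theorem coe_sum_p (u : M) (hu : u ∈ cent ι) :
    ∑ j, X.trace₀ T (D.q j * u * D.d) • (D.p j : M) = u := by
  have h := congrArg Subtype.val (D.sum_p ⟨u, hu⟩)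
  simpa using h

theorem coe_sum_q (u : M) (hu : u ∈ cent ι) :
    ∑ j, X.trace₀ T (D.p j * u * D.d) • (D.q j : M) = u := by
  have h := congrArg Subtype.val (D.sum_q ⟨u, hu⟩)
  simpa using h

theorem evA_one_mem' (a : centA ι) : evA a 1 ∈ cent ι := evA_one_mem a 1

theorem trace₀_mul_p (u : M) (hu : u ∈ cent ι) (j : Fin D.m) :
    X.trace₀ T (u * D.p j * D.d) = X.trace₀ T (D.p j * u * D.d) := by
  have h := congrArg Subtype.val (D.d_comm ⟨u, hu⟩)
  simp only [Subalgebra.coe_mul] at h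
  rw [mul_assoc, D.markov.trace₀_comm, mul_assoc, h, mul_assoc]

theorem trace₀_mul_q (u : M) (hu : u ∈ cent ι) (j : Fin D.m) :
    X.trace₀ T (u * D.q j * D.d) = X.trace₀ T (D.q j * u * D.d) := by
  have h := congrArg Subtype.val (D.d_comm ⟨u, hu⟩)
  simp only [Subalgebra.coe_mul] at h
  rw [mul_assoc, D.markov.trace₀_comm, mul_assoc, h, mul_assoc]

theorem coe_sum_p' (u : M) (hu : u ∈ cent ι) :
    ∑ j, X.trace₀ T (u * D.q j * D.d) • (D.p j : M) = u := by
  simp only [D.trace₀_mul_q u hu, D.coe_sum_p u hu]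

theorem coe_sum_q' (u : M) (hu : u ∈ cent ι) :
    ∑ j, X.trace₀ T (u * D.p j * D.d) • (D.q j : M) = u := by
  simp only [D.trace₀_mul_p u hu, D.coe_sum_q u hu]

/-- The map `a ↦ a(1)` from `A` to `U`. -/
noncomputable def atOne : centA ι →ₗ[k] cent ι where
  toFun a := actU a 1
  map_add' a b := Subtype.ext (by simp)
  map_smul' c a := Subtype.ext (by simp)

@[simp] theorem coe_atOne (a : centA ι) : (atOne a : M) = evA a 1 := rfl

theorem proj_mul_tmul_eq (a b : centA ι) :
    D.proj * (a ⊗ₜ[k] b) = ∑ j, (rA (D.p j) * a) ⊗ₜ[k] (lA (D.q j) * b) := by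
  simp [proj, Finset.sum_mul]

/-- T₀(· d) has the dual bases p_j, q_j on U, so the sum over Δ(1) collapses to a(1). With b = 1
this is ε_t(a) = L_{a(1)}. -/
theorem lid_eps_proj (a b : centA ι) : TensorProduct.lid k (centA ι)
    (D.eps.rTensor (centA ι) (D.proj * (a ⊗ₜ[k] b))) = lA (atOne a) * b := by
  rw [proj_mul_tmul_eq]
  simp only [map_sum, LinearMap.rTensor_tmul, TensorProduct.lid_tmul, eps_apply, evA_mul, evA_rA]
  have h : ∑ j, X.trace₀ T (evA a 1 * D.p j * D.d) • D.q j = atOne a := Subtype.ext (by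
    have := D.coe_sum_q' (evA a 1) (evA_one_mem' a)
    simpa using this)
  rw [← h, map_sum, Finset.sum_mul]
  simp

theorem rid_eps_proj (a b : centA ι) : TensorProduct.rid k (centA ι)
    (D.eps.lTensor (centA ι) (D.proj * (a ⊗ₜ[k] b))) = rA (atOne b) * a := by
  rw [proj_mul_tmul_eq]
  simp only [map_sum, LinearMap.lTensor_tmul, TensorProduct.rid_tmul, eps_apply, evA_mul, evA_lA]
  have h : ∑ j, X.trace₀ T (D.q j * evA b 1 * D.d) • D.p j = atOne b := Subtype.ext (by
    have := D.coe_sum_p (evA b 1) (evA_one_mem' b)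
    simpa using this)
  rw [← h, map_sum, Finset.sum_mul]
  simp

/-- With this, the left counit law becomes a·m = a₁(m)a₂ at m = 1; with `evA_rid_eps`, the right one
becomes the same identity applied to 1 ∈ M. -/
theorem coe_lid_eps (t : centA ι ⊗[k] centA ι) : ((TensorProduct.lid k (centA ι)
    (D.eps.rTensor (centA ι) (D.proj * t)) : centA ι) : EndRight ι) = gamma t 1 := by
  induction t with
  | zero => simp
  | add a b ha hb => simp only [mul_add, map_add, LinearMap.add_apply, Subalgebra.coe_add, ha, hb]
  | tmul a b => rw [lid_eps_proj]; rfl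

theorem evA_rid_eps (t : centA ι ⊗[k] centA ι) (m : M) : evA (TensorProduct.rid k (centA ι)
    (D.eps.lTensor (centA ι) (D.proj * t))) m = (gamma t m).val 1 := by
  induction t with
  | zero => simp
  | add a b ha hb => simp only [mul_add, map_add, LinearMap.add_apply, ha, hb]
  | tmul a b => rw [rid_eps_proj]; rfl

theorem lid_eps_delta (a : centA ι) :
    TensorProduct.lid k (centA ι) (D.eps.rTensor (centA ι) (D.delta a)) = a :=
  Subtype.ext (by rw [← proj_mul_delta, coe_lid_eps, gamma_delta, map_one, mul_one])

theorem rid_eps_delta (a : centA ι) :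
    TensorProduct.rid k (centA ι) (D.eps.lTensor (centA ι) (D.delta a)) = a :=
  centA_ext fun m => by
    rw [← proj_mul_delta, evA_rid_eps, gamma_delta, EndRight.val_mul_apply, leftMul_apply,
      mul_one, evA_def]

/-- The sum over Δ(1) collapses to T₀(a(b₁(1) b₂(c(1))) d), and b₁(1)b₂ = b in M₁. -/
theorem eps_mul_mul (a b c : centA ι) : D.eps (a * b * c) =
    LinearMap.mul' k k (TensorProduct.map (D.eps ∘ₗ LinearMap.mulLeft k a)
      (D.eps ∘ₗ LinearMap.mulRight k c) (D.delta b)) := by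
  have key : ∀ t : centA ι ⊗[k] centA ι, LinearMap.mul' k k (TensorProduct.map
      (D.eps ∘ₗ LinearMap.mulLeft k a) (D.eps ∘ₗ LinearMap.mulRight k c) (D.proj * t)) =
      X.trace₀ T (evA a ((gamma t 1).val (evA c 1)) * D.d) := by
    intro t
    induction t with
    | zero => simp
    | add x y hx hy => simp only [mul_add, map_add, LinearMap.add_apply, add_mul, hx, hy]
    | tmul x y =>
      have h := D.coe_sum_p (evA y (evA c 1)) (evA_one_mem y (atOne c))
      rw [proj_mul_tmul_eq, gamma_tmul, EndRight.val_mul_apply, leftMul_apply, ← evA_def, ← h]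
      simp only [map_sum, TensorProduct.map_tmul, LinearMap.mul'_apply, LinearMap.comp_apply,
        LinearMap.mulLeft_apply, LinearMap.mulRight_apply, eps_apply, evA_mul, evA_rA, evA_lA,
        Finset.mul_sum, Finset.sum_mul, mul_smul_comm, smul_mul_assoc, map_smul, smul_eq_mul]
      exact Finset.sum_congr rfl fun j _ => mul_comm _ _
  rw [← proj_mul_delta, key, gamma_delta, map_one, mul_one, eps_apply, evA_mul, evA_mul]
  rfl

/-- The legs now occur as b₁(c(1)) b₂(1), the value at 1 of b·c(1) ∈ M₁. -/
theorem eps_mul_mul' (a b c : centA ι) : D.eps (a * b * c) =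
    LinearMap.mul' k k (TensorProduct.map (D.eps ∘ₗ LinearMap.mulRight k c)
      (D.eps ∘ₗ LinearMap.mulLeft k a) (D.delta b)) := by
  have key : ∀ t : centA ι ⊗[k] centA ι, LinearMap.mul' k k (TensorProduct.map
      (D.eps ∘ₗ LinearMap.mulRight k c) (D.eps ∘ₗ LinearMap.mulLeft k a) (D.proj * t)) =
      X.trace₀ T (evA a ((gamma t (evA c 1)).val 1) * D.d) := by
    intro t
    induction t with
    | zero => simp
    | add x y hx hy => simp only [mul_add, map_add, LinearMap.add_apply, add_mul, hx, hy]
    | tmul x y =>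
      have h := D.coe_sum_q' (evA x (evA c 1)) (evA_one_mem x (atOne c))
      rw [proj_mul_tmul_eq, gamma_tmul, EndRight.val_mul_apply, leftMul_apply, ← evA_def]
      conv_rhs => rw [← h]
      simp only [map_sum, TensorProduct.map_tmul, LinearMap.mul'_apply, LinearMap.comp_apply,
        LinearMap.mulLeft_apply, LinearMap.mulRight_apply, eps_apply, evA_mul, evA_rA, evA_lA,
        Finset.sum_mul, smul_mul_assoc, map_smul, smul_eq_mul]
  rw [← proj_mul_delta, key, gamma_delta, eps_apply, evA_mul, evA_mul, EndRight.val_mul_apply,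
    leftMul_apply, mul_one]
  rfl

theorem rA_mul_lA_mul (u v : cent ι) (a : centA ι) : rA v * (lA u * a) = lA u * (rA v * a) := by
  rw [← mul_assoc, ← lA_rA_comm, mul_assoc]

set_option synthInstance.maxHeartbeats 200000 in
theorem assoc_symm_proj : (TensorProduct.assoc k (centA ι) (centA ι) (centA ι)).symm
    ((1 : centA ι) ⊗ₜ[k] D.proj) = ∑ j, ((1 : centA ι) ⊗ₜ[k] rA (D.p j)) ⊗ₜ[k] lA (D.q j) := by
  simp [proj, TensorProduct.tmul_sum]

theorem delta_proj : D.delta.rTensor (centA ι) D.proj = (D.proj ⊗ₜ[k] (1 : centA ι)) *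
    (TensorProduct.assoc k (centA ι) (centA ι) (centA ι)).symm ((1 : centA ι) ⊗ₜ[k] D.proj) := by
  rw [assoc_symm_proj]
  conv_lhs => rw [proj.eq_1 D]
  simp [Finset.mul_sum, delta_rA]

/-- The two factors meet only in the middle leg, where one is a left and the other a right
multiplication, and these commute. -/
theorem delta_proj' : D.delta.rTensor (centA ι) D.proj =
    (TensorProduct.assoc k (centA ι) (centA ι) (centA ι)).symm ((1 : centA ι) ⊗ₜ[k] D.proj) *
      (D.proj ⊗ₜ[k] (1 : centA ι)) := by
  rw [delta_proj, assoc_symm_proj]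
  simp only [proj, TensorProduct.sum_tmul, Finset.mul_sum, Finset.sum_mul,
    Algebra.TensorProduct.tmul_mul_tmul, one_mul, mul_one, lA_rA_comm]
  rw [Finset.sum_comm]

/-! ### The antipode laws -/

/-- The antipode `S(a) = R_w⁻¹ ā R_w`. -/
noncomputable def anti : centA ι →ₗ[k] centA ι :=
  LinearMap.mulLeft k (rA D.d') ∘ₗ LinearMap.mulRight k (rA D.d) ∘ₗ X.bar

theorem anti_apply (a : centA ι) : D.anti a = rA D.d' * (X.bar a * rA D.d) := rfl

theorem lid_proj_target (a : centA ι) : TensorProduct.lid k (centA ι)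
    (D.eps.rTensor (centA ι) (D.proj * (a ⊗ₜ[k] 1))) = lA (atOne a) := by
  rw [lid_eps_proj, mul_one]

/-- Adjunction gives ε(a L_{q_j}) = T₀(a(q_j)d) = T₀(ā(d)q_j), and these are the coefficients of
ā(d)d' with respect to the p_j. This computes ε_s(a). -/
theorem rid_proj_source (a : centA ι) : TensorProduct.rid k (centA ι)
    (D.eps.lTensor (centA ι) ((1 ⊗ₜ[k] a) * D.proj)) = rA (actU (X.bar a) D.d * D.d') := by
  have h := D.coe_sum_p' (evA (X.bar a) D.d * D.d') (actU (X.bar a) D.d * D.d').2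
  have h' : actU (X.bar a) D.d * D.d' =
      ∑ j, X.trace₀ T (evA (X.bar a) D.d * D.q j) • D.p j := Subtype.ext (by
    simp only [Subalgebra.coe_mul, coe_actU, AddSubmonoidClass.coe_finsetSum, Subalgebra.coe_smul]
    conv_lhs => rw [← h]
    refine Finset.sum_congr rfl fun j _ => ?_
    have e := congrArg Subtype.val (D.d'_comm (D.q j * D.d))
    rw [mul_assoc (D.q j), D.d_mul, mul_one] at e
    simp only [Subalgebra.coe_mul] at e
    rw [mul_assoc, mul_assoc, e])
  rw [h', map_sum]
  simp only [proj, Finset.mul_sum, Algebra.TensorProduct.tmul_mul_tmul, one_mul, map_sum,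
    LinearMap.lTensor_tmul, TensorProduct.rid_tmul, eps_apply, evA_mul, evA_lA, mul_one, map_smul]
  refine Finset.sum_congr rfl fun j _ => ?_
  rw [D.markov.trace₀_comm, trace₀_bar]

theorem sum_z_leftMul (m : M) :
    ∑ i, (D.z i : EndRight ι) * leftMul ι (evA (D.w i) m) = X.lam⁻¹ • (leftMul ι m * X.e) := by
  rw [← D.dual_right (leftMul ι m * X.e), Finset.smul_sum]
  refine Finset.sum_congr rfl fun i _ => ?_
  rw [← mul_assoc, basic_E_mul_e_mul', map_smul, mul_smul_comm, smul_smul,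
    inv_mul_cancel₀ X.lam_ne_zero, one_smul, evA_def]

/-- Under S the leg R_{p_j} turns into L_{p_j} and meets L_{q_j}, so Δ(1) disappears. By `bar_cross`
the rest evaluates at m to ∑ E_M(z_i w_i(m) d a) d' = λ⁻¹ m E_M(e₁ d a) d' = m ā(d) d'. -/
theorem anti_mul (a : centA ι) : LinearMap.mul' k (centA ι)
    (D.anti.rTensor (centA ι) (D.delta a)) = rA (actU (X.bar a) D.d * D.d') := by
  have key : ∀ b c : centA ι, LinearMap.mul' k (centA ι)
      (D.anti.rTensor (centA ι) (D.proj * (b ⊗ₜ[k] c))) =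
      rA D.d' * (X.bar b * (rA D.d * c)) := by
    intro b c
    simp only [proj_mul_tmul_eq, map_sum, LinearMap.rTensor_tmul, LinearMap.mul'_apply,
      anti_apply, X.bar_mul, bar_rA D.symm]
    have h : ∀ j, rA D.d' * (X.bar b * lA (D.p j) * rA D.d) * (lA (D.q j) * c) =
        rA D.d' * X.bar b * (lA (D.p j * D.q j)) * (rA D.d * c) := fun j => by
      simp only [lA_mul, mul_assoc, rA_mul_lA_mul]
    simp only [h, ← Finset.sum_mul, ← Finset.mul_sum, ← map_sum, D.sum_mul, lA_one, mul_one]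
    simp only [mul_assoc]
  simp only [delta_apply, Finset.mul_sum, map_sum, key, D.bar_cross]
  refine centA_ext fun m => ?_
  rw [← Finset.mul_sum, evA_mul, map_sum, LinearMap.sum_apply]
  simp only [evA_rA, evA_mul, evA_cross, map_mul (leftMul ι), ← mul_assoc, Subalgebra.coe_mul, coe_actU]
  rw [← map_sum, ← Finset.sum_mul, ← Finset.sum_mul, sum_z_leftMul]
  simp only [smul_mul_assoc, mul_assoc, map_smul, X.basic.E_left]
  rw [← mul_assoc X.e, basic_E_e_mul, smul_mul_assoc, mul_smul_comm, smul_smul,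
    inv_mul_cancel₀ X.lam_ne_zero, one_smul]

/-- The definition of Δ, written with the dual bases of T₁, followed by their symmetry. The second
leg now carries `Q₁`, to which S can be applied in `mul_anti`. -/
theorem delta_eq_sum_Q (a : centA ι) :
    D.delta a = ∑ s, X.cross a (D.Q₂ s) ⊗ₜ[k] (lA D.d' * D.Q₁ s) := by
  have h := congrArg (TensorProduct.map (X.cross a) (LinearMap.mulLeft k (lA D.d'))) D.sum_Q_symm
  simp only [map_sum, TensorProduct.map_tmul, LinearMap.mulLeft_apply] at h
  rw [← h, Fintype.sum_prod_type, delta_apply, Finset.mul_sum]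
  refine Finset.sum_congr rfl fun i _ => ?_
  rw [proj_mul_tmul_eq]
  refine Finset.sum_congr rfl fun j _ => ?_
  rw [Q₁, Q₂, cross_mul_lA, ← mul_assoc, ← lA_mul, D.d'_comm, mul_assoc _ D.d,
    D.d_mul, mul_one]

/-- The weight d in `Q₂` cancels d', and ∑ p_j q_j = 1 leaves the dual bases z_i, w_i of E_M. -/
theorem sum_Q_leftMul (f : EndRight ι) :
    ∑ s, leftMul ι (X.basic.E (f * D.Q₁ s) * D.d') * (D.Q₂ s : EndRight ι) = f := by
  rw [Fintype.sum_prod_type]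
  conv_rhs => rw [← D.dual_left f]
  refine Finset.sum_congr rfl fun i _ => ?_
  have h : ∀ j, leftMul ι (X.basic.E (f * D.Q₁ (i, j)) * D.d') * (D.Q₂ (i, j) : EndRight ι) =
      leftMul ι (X.basic.E (f * D.z i)) * leftMul ι ((D.p j * D.q j : cent ι) : M) * D.w i := by
    intro j
    have e : D.d' * (D.q j * D.d) = D.q j := by
      rw [D.d'_comm, mul_assoc, D.d_mul, mul_one]
    have e' := congrArg Subtype.val e
    simp only [Subalgebra.coe_mul] at e'
    rw [Q₁, Q₂, Subalgebra.coe_mul, Subalgebra.coe_mul, coe_lA, coe_lA, ← mul_assoc f,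
      X.basic.E_right, ← mul_assoc, ← map_mul, ← map_mul, Subalgebra.coe_mul, Subalgebra.coe_mul,
      mul_assoc, mul_assoc, e']
  simp only [h, ← Finset.sum_mul, ← Finset.mul_sum, ← map_sum]
  rw [← AddSubmonoidClass.coe_finsetSum, D.sum_mul]
  simp

/-- The adjoint of `Q₁` sends m to λ⁻¹E_M(e₁ m Q₁), so the sum reproduces e₁m and the value at m is
λ⁻¹E_M(a e₁ m) = a(1)m. -/
theorem mul_anti (a : centA ι) : LinearMap.mul' k (centA ι)
    (D.anti.lTensor (centA ι) (D.delta a)) = lA (atOne a) := by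
  rw [delta_eq_sum_Q]
  have h : ∀ s, X.cross a (D.Q₂ s) * D.anti (lA D.d' * D.Q₁ s) =
      X.cross a (D.Q₂ s) * rA D.d' * X.bar (D.Q₁ s) := fun s => by
    rw [anti_apply, bar_mul, bar_lA, mul_assoc (X.bar _), ← rA_mul, D.d_mul, rA_one, mul_one,
      mul_assoc]
  simp only [map_sum, LinearMap.lTensor_tmul, LinearMap.mul'_apply, h]
  refine centA_ext fun m => ?_
  have h2 : ∀ s, evA (X.bar (D.Q₁ s)) m = X.lam⁻¹ • X.basic.E (X.e * leftMul ι m * D.Q₁ s) :=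
    fun s => by
      rw [basic_E_e_mul, smul_smul, inv_mul_cancel₀ X.lam_ne_zero, one_smul]
  simp only [map_sum, LinearMap.sum_apply, evA_mul, evA_rA, evA_cross, h2, map_smul,
    mul_assoc (a : EndRight ι)]
  rw [← Finset.smul_sum, ← map_sum, ← Finset.mul_sum, sum_Q_leftMul, ← mul_assoc,
    X.basic.E_right, basic_E_mul_e, smul_mul_assoc, smul_smul, inv_mul_cancel₀ X.lam_ne_zero,
    one_smul]
  rfl

/-- The adjoint again turns R_{p_j} into L_{p_j}, which cancels against q_j; what remains is S
applied to (id ⊗ ε)Δ(a) = a. -/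
theorem anti_mul_target (a : centA ι) : LinearMap.mul' k (centA ι)
    (TensorProduct.map D.anti (lA ∘ₗ atOne) (D.delta a)) = D.anti a := by
  have key : ∀ t : centA ι ⊗[k] centA ι, LinearMap.mul' k (centA ι)
      (TensorProduct.map D.anti (lA ∘ₗ atOne) (D.proj * t)) =
      D.anti (TensorProduct.rid k (centA ι) (D.eps.lTensor (centA ι) (D.proj * t))) := by
    intro t
    induction t with
    | zero => simp
    | add x y hx hy => simp only [mul_add, map_add, hx, hy]
    | tmul x y =>
      have h : ∀ j, atOne (lA (D.q j) * y) = D.q j * atOne y := fun j => Subtype.ext (by simp)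
      have h2 : ∀ j, rA D.d' * (X.bar x * lA (D.p j) * rA D.d) * lA (D.q j * atOne y) =
        rA D.d' * X.bar x * (lA (D.p j * D.q j)) * (lA (atOne y) * rA D.d) := fun j => by
        simp only [lA_mul, mul_assoc, rA_mul_lA_mul, ← lA_rA_comm]
      rw [rid_eps_proj]
      simp only [proj_mul_tmul_eq, map_sum, TensorProduct.map_tmul, LinearMap.mul'_apply,
        LinearMap.comp_apply, anti_apply, bar_mul, bar_rA D.symm, h, h2]
      simp only [← Finset.sum_mul, ← Finset.mul_sum, ← map_sum, D.sum_mul, lA_one, mul_one]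
      simp only [mul_assoc]
  rw [← proj_mul_delta, key, proj_mul_delta, rid_eps_delta]

end DepthTwoData
end StronglySeparableExt

namespace StronglySeparableExt

variable {ι : N →ₐ[k] M} {X : StronglySeparableExt ι} {T : N →ₗ[k] k}

namespace DepthTwoData

/-! ### Invariance of T₁ under the adjoint -/

section Unimodular

theorem basic_E_rA (u : cent ι) :
    X.basic.E (rA u : centA ι) = X.lam • ∑ i, X.x i * (u * X.y i) := by
  simp only [basic_E_apply, ← evA_def, evA_rA, mul_assoc]

theorem basic_E_und (a : centA ι) :
    X.basic.E (X.und a : centA ι) = X.lam • ∑ i, X.x i * evA a (X.y i) := by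
  simp only [basic_E_apply, ← evA_def, evA_und, Finset.sum_mul, mul_assoc]
  rw [Finset.sum_comm]
  simp only [← Finset.mul_sum, X.dual_left]

/-- `T₁(und a) = T₁(a)`: both sides are the value at `Δ(a)` of
`x ⊗ y ↦ T₀(E_M(und x) E_M(y))`. -/
theorem trace₁_und (D : X.DepthTwoData T) (a : centA ι) :
    X.trace₁ T (X.und a : centA ι) = X.trace₁ T (a : EndRight ι) := by
  let F : centA ι ⊗[k] centA ι →ₗ[k] k := TensorProduct.lift
    (LinearMap.mk₂ k (fun x y : centA ι => X.trace₀ T (X.EU (X.und x) * X.EU y : cent ι))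
      (fun x x' y => by simp [add_mul]) (fun c x y => by simp)
      (fun x y y' => by simp [mul_add]) (fun c x y => by simp))
  have hF : ∀ x y : centA ι, F (x ⊗ₜ y) = X.trace₀ T (X.EU (X.und x) * X.EU y : cent ι) :=
    fun x y => rfl
  -- F must be expressed through `gamma`, because `gamma` is what is known on Δ(a). The first
  -- expression keeps E_M intact, the second expands it.
  have h₁ : ∀ t, F t =
      X.lam * ∑ i, X.trace₀ T (X.x i * X.basic.E (gamma t (X.y i))) := by
    intro t
    induction t with
    | zero => simp
    | add x y hx hy =>
      simp only [map_add, LinearMap.add_apply, hx, hy, mul_add, Finset.sum_add_distrib]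
    | tmul x y =>
      simp only [hF, Subalgebra.coe_mul, coe_EU, basic_E_und, gamma_tmul, X.basic.E_left,
        smul_mul_assoc, map_smul, smul_eq_mul, Finset.sum_mul, map_sum, mul_assoc]
  have h₂ : ∀ t, F t = X.lam * (X.lam *
      ∑ j, ∑ i, X.trace₀ T (X.x i * (gamma t (X.y i)).val (X.x j) * X.y j)) := by
    intro t
    induction t with
    | zero => simp
    | add x y hx hy =>
      simp only [map_add, LinearMap.add_apply, hx, hy, mul_add, add_mul, Finset.sum_add_distrib]
    | tmul x y =>
      simp only [hF, Subalgebra.coe_mul, coe_EU, basic_E_und, gamma_tmul]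
      simp only [basic_E_apply, EndRight.val_mul_apply, leftMul_apply, evA_def,
        smul_mul_assoc, mul_smul_comm, map_smul, smul_eq_mul, Finset.sum_mul, Finset.mul_sum,
        map_sum, mul_assoc]
  -- Here F(Δ(a)) = T₁(R_u) with u = E_M(a), and T₁(R_u) = T₀(u).
  have e₁ : F (D.delta a) = X.trace₁ T (a : EndRight ι) := by
    have h := D.trace_rA (X.EU a)
    rw [trace₁_apply, basic_E_rA, map_smul, smul_eq_mul, map_sum] at h
    rw [h₁]
    simp only [gamma_delta, X.basic.E_right]
    exact h
  -- Here the Casimir property gives F(Δ(a)) = T₁(R_u) with u = E_M(und a).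
  have e₂ : F (D.delta a) = X.trace₁ T (X.und a : centA ι) := by
    have h := D.trace_rA (X.EU (X.und a))
    rw [trace₁_apply, basic_E_rA, map_smul, smul_eq_mul, map_sum] at h
    refine Eq.trans ?_ h
    rw [h₂]
    simp only [gamma_delta, coe_EU, basic_E_und]
    rw [Finset.mul_sum]
    congr 1
    refine Finset.sum_congr rfl fun j _ => ?_
    rw [smul_mul_assoc, mul_smul_comm, map_smul, smul_eq_mul, ← map_sum, ← Finset.sum_mul,
      ← mul_assoc]
    congr 3
    have c := X.sum_casimir (fun p q => p * evA a q) (X.x j)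
      (fun s b => by simp [Finset.sum_mul]) (fun s b => by simp [Finset.mul_sum])
      (fun p n q => by simp [evA_left, mul_assoc])
    simp only [EndRight.val_mul_apply, leftMul_apply, ← evA_def]
    rw [← c, Finset.mul_sum]
    simp only [mul_assoc]
  rw [← e₂, e₁]

theorem trace₁_bar (D : X.DepthTwoData T) (a : centA ι) :
    X.trace₁ T (X.bar a : centA ι) = X.trace₁ T (a : EndRight ι) := by
  rw [← D.trace₁_und (X.bar a), und_bar]

end Unimodular

/-! ### The pairing and the product of B, transported to A -/

section Pairing

variable (X) in
/-- The product on `A` that corresponds to the product of `B`. -/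
noncomputable def star (c c' : centA ι) : centA ι := centA.mk
  { toFun := fun m => ∑ j, evA c' (X.x j) * evA c (X.y j * m)
    map_add' := fun m m' => by simp [mul_add, Finset.sum_add_distrib]
    map_smul' := fun a m => by simp [Finset.smul_sum] }
  (fun n m => by
    have h := X.sum_casimir (fun p q => evA c' p * evA c (q * m)) (ι n)
      (fun s b => by simp [Finset.sum_mul]) (fun s b => by simp [Finset.mul_sum, Finset.sum_mul])
      (fun p n q => by simp [evA_left, evA_right, mul_assoc])
    simp only [LinearMap.coe_mk, AddHom.coe_mk]
    simp only [evA_left, mul_assoc] at h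
    rw [← h, Finset.mul_sum])
  (fun m n => by
    simp only [LinearMap.coe_mk, AddHom.coe_mk, ← mul_assoc, evA_right, Finset.sum_mul])

theorem evA_star (c c' : centA ι) (m : M) :
    evA (star X c c') m = ∑ j, evA c' (X.x j) * evA c (X.y j * m) := rfl

theorem evA_star' (c c' : centA ι) (m m' : M) :
    evA (star X c c') (m * m') = ∑ j, evA c' (m * X.x j) * evA c (X.y j * m') := by
  have h := X.sum_casimir (fun p q => evA c' p * evA c (q * m')) m
    (fun s b => by simp [Finset.sum_mul]) (fun s b => by simp [Finset.mul_sum, Finset.sum_mul])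
    (fun p n q => by simp [evA_left, evA_right, mul_assoc])
  simp only [mul_assoc] at h
  exact h.symm

/-- Both sides send m to ∑ c''(x_j) c'(y_j x_l) c(y_l m). -/
theorem star_assoc (c c' c'' : centA ι) :
    star X (star X c c') c'' = star X c (star X c' c'') :=
  centA_ext fun m => by
    rw [evA_star, evA_star]
    simp only [evA_star']
    simp only [evA_star, Finset.mul_sum, Finset.sum_mul]
    rw [Finset.sum_comm]
    simp only [mul_assoc]

variable (D : X.DepthTwoData T)

/-- The functional `a ↦ ∑ T₀(a(x_i) c(y_i) w)` on `A`. -/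
noncomputable def pair (c : centA ι) : centA ι →ₗ[k] k where
  toFun a := X.trace₀ T (∑ i, evA a (X.x i) * evA c (X.y i) * D.d)
  map_add' a b := by simp [add_mul, Finset.sum_add_distrib]
  map_smul' r a := by simp [Finset.mul_sum]

theorem pair_apply (a c : centA ι) :
    D.pair c a = X.trace₀ T (∑ i, evA a (X.x i) * evA c (X.y i) * D.d) := rfl

/-- Since c is the adjoint of `und c`, its values expand with coefficients in N, which a absorbs by
right N-linearity. -/
theorem sum_evA_mul_evA (a c : centA ι) : ∑ i, evA a (X.x i) * evA c (X.y i) =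
    ∑ i, evA a (evA (X.und c) (X.x i)) * X.y i := by
  have h : ∀ i, evA c (X.y i) =
      ∑ j, ι (X.E (X.y i * evA (X.und c) (X.x j))) * X.y j := fun i => by
    rw [← evA_bar, bar_und]
  simp only [h, Finset.mul_sum, ← mul_assoc, ← evA_right]
  rw [Finset.sum_comm]
  simp only [← Finset.sum_mul, ← map_sum, X.dual_right]

/-- In this form the pairing differs from (a, c) ↦ T₁(ac) only by invertible factors and the
bijection `und`, so it inherits non-degeneracy. -/
theorem pair_eq (a c : centA ι) :
    D.pair c a = X.lam⁻¹ * X.trace₁ T (lA D.d * (a * X.und c) : centA ι) := by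
  rw [D.trace₁_comm, trace₁_mul_lA, Subalgebra.coe_mul, coe_EU, basic_E_apply, smul_mul_assoc,
    map_smul, smul_eq_mul, ← mul_assoc, inv_mul_cancel₀ X.lam_ne_zero, one_mul, pair_apply,
    ← Finset.sum_mul, sum_evA_mul_evA]
  rfl

theorem tr_mulRight (b : centA ι) : tr X T ∘ₗ LinearMap.mulRight k b =
    X.lam • D.pair (X.bar (b * lA D.d')) := by
  ext a
  have e : lA D.d' * lA D.d = (1 : centA ι) := by rw [← lA_mul, D.d'_mul, lA_one]
  rw [LinearMap.smul_apply, pair_eq, und_bar, D.trace₁_comm, mul_assoc, mul_assoc, e, mul_one,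
    smul_eq_mul, ← mul_assoc, mul_inv_cancel₀ X.lam_ne_zero, one_mul]
  rfl

theorem tensor_ext (D : X.DepthTwoData T) {G : Type*} [AddCommGroup G] [Module k G]
    {s t : centA ι ⊗[k] G} (h : ∀ c, TensorProduct.lid k G ((D.pair c).rTensor G s) =
      TensorProduct.lid k G ((D.pair c).rTensor G t)) : s = t := by
  refine sub_eq_zero.1 (D.tensor_eq_zero fun c => ?_)
  rw [tr_mulRight, LinearMap.rTensor_smul, LinearMap.smul_apply, map_sub,
    (TensorProduct.lid k G).injective (h _), sub_self, smul_zero]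

theorem eq_of_pair {a b : centA ι} (h : ∀ c, D.pair c a = D.pair c b) : a = b :=
  D.eq_of_trace₁ fun c => by
    have e := fun x => LinearMap.congr_fun (D.tr_mulRight c) x
    simp only [LinearMap.comp_apply, LinearMap.mulRight_apply, tr_apply] at e
    rw [e, e, LinearMap.smul_apply, h, LinearMap.smul_apply]

theorem mul'_map_pair {G : Type*} [AddCommGroup G] [Module k G] (f : centA ι →ₗ[k] k)
    (g : G →ₗ[k] k) (t : centA ι ⊗[k] G) : LinearMap.mul' k k (TensorProduct.map f g t) =
      g (TensorProduct.lid k G (f.rTensor G t)) := by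
  induction t with
  | zero => simp
  | add x y hx hy => simp only [map_add, hx, hy]
  | tmul x y => simp

theorem tensor_ext₂ (D : X.DepthTwoData T) {s t : centA ι ⊗[k] centA ι}
    (h : ∀ c c', LinearMap.mul' k k (TensorProduct.map (D.pair c) (D.pair c') s) =
      LinearMap.mul' k k (TensorProduct.map (D.pair c) (D.pair c') t)) : s = t :=
  D.tensor_ext fun c => D.eq_of_pair fun c' => by
    rw [← mul'_map_pair, ← mul'_map_pair, h]

/-- After Δ(1) collapses, only a·x_i = a₁(x_i)a₂ is needed; the Casimir property then moves y_i
across to form `star`. -/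
theorem pair_delta (a c c' : centA ι) : LinearMap.mul' k k
    (TensorProduct.map (D.pair c) (D.pair c') (D.delta a)) = D.pair (star X c c') a := by
  have key : ∀ t, LinearMap.mul' k k (TensorProduct.map (D.pair c) (D.pair c') (D.proj * t)) =
      X.trace₀ T (∑ i, ∑ l, (gamma t (X.x i)).val (X.x l) * evA c' (X.y l) * evA c (X.y i) *
        D.d) := by
    intro t
    induction t with
    | zero => simp
    | add x y hx hy =>
      simp only [mul_add, map_add, LinearMap.add_apply, add_mul, Finset.sum_add_distrib, hx, hy]
    | tmul x y =>
      -- This sum is λ⁻¹E_M(y · und c'), hence lies in U and can be expanded in the p_j.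
      have hz : ∑ l, evA y (X.x l) * evA c' (X.y l) ∈ cent ι := by
        rw [sum_evA_mul_evA]
        have h := (X.EU (y * X.und c')).2
        rw [coe_EU, basic_E_apply] at h
        have h' := Subalgebra.smul_mem _ h X.lam⁻¹
        rwa [smul_smul, inv_mul_cancel₀ X.lam_ne_zero, one_smul] at h'
      have h := D.coe_sum_p _ hz
      simp only [gamma_tmul, EndRight.val_mul_apply, leftMul_apply, ← evA_def, mul_assoc (evA x _)]
      simp only [← mul_assoc (evA x _), ← Finset.sum_mul]
      simp only [mul_assoc (evA x _), ← Finset.mul_sum]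
      rw [← h]
      simp only [proj_mul_tmul_eq, map_sum, TensorProduct.map_tmul, LinearMap.mul'_apply,
        pair_apply, evA_mul, evA_rA, evA_lA, Finset.sum_mul, Finset.mul_sum, smul_mul_assoc,
        mul_smul_comm, map_smul, smul_eq_mul, mul_assoc]
      conv_rhs => rw [Finset.sum_comm]
      refine Finset.sum_congr rfl fun j _ => ?_
      rw [Finset.sum_comm]
      exact Finset.sum_congr rfl fun i _ => Finset.sum_congr rfl fun l _ => mul_comm _ _
  rw [← proj_mul_delta, key, pair_apply]
  congr 1
  simp only [gamma_delta, EndRight.val_mul_apply, leftMul_apply, ← evA_def, ← Finset.sum_mul]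
  congr 1
  have e1 : ∀ i, evA (star X c c') (X.y i) = ∑ j, evA c' (X.y i * X.x j) * evA c (X.y j) :=
    fun i => by rw [← mul_one (X.y i), evA_star']; simp
  have e2 : ∀ m, ∑ i, evA a (X.x i) * evA c' (X.y i * m) =
      ∑ i, evA a (m * X.x i) * evA c' (X.y i) := fun m =>
    (X.sum_casimir (fun p q => evA a p * evA c' q) m
      (fun s b => by simp [Finset.sum_mul]) (fun s b => by simp [Finset.mul_sum])
      (fun p n q => by simp [evA_left, evA_right, mul_assoc])).symm
  simp only [e1, Finset.mul_sum, ← mul_assoc]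
  conv_rhs => rw [Finset.sum_comm]
  simp only [← Finset.sum_mul, e2]

end Pairing

end DepthTwoData
end StronglySeparableExt

/-! ### Extensionality of weak Hopf structures and tensor bookkeeping -/

theorem WeakHopfAlgebra.ext_of_eq {k H : Type*} [Field k] [Ring H] [Algebra k H]
    {W W' : WeakHopfAlgebra k H} (h₁ : W.comul = W'.comul) (h₂ : W.counit = W'.counit)
    (h₃ : W.antipode = W'.antipode) : W = W' := by
  obtain @⟨@⟨⟨c, e⟩, _, _, _⟩, s, _, _, _, _, _, _, _, _⟩ := W
  obtain @⟨@⟨⟨c', e'⟩, _, _, _⟩, s', _, _, _, _, _, _, _, _⟩ := W'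
  dsimp only at h₁ h₂ h₃
  subst h₁ h₂ h₃
  rfl

section TensorIdentities

variable {H : Type*} [Ring H] [Algebra k H]

theorem mul'_map_assoc_comul {Δ : H →ₗ[k] H ⊗[k] H} {f g h F : H →ₗ[k] k}
    (hF : ∀ x, LinearMap.mul' k k (TensorProduct.map f g (Δ x)) = F x) (t : H ⊗[k] H) :
    LinearMap.mul' k k (TensorProduct.map f (LinearMap.mul' k k ∘ₗ TensorProduct.map g h)
      (TensorProduct.assoc k _ _ _ (Δ.rTensor H t))) =
    LinearMap.mul' k k (TensorProduct.map F h t) := by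
  induction t with
  | zero => simp
  | add x y hx hy => simp only [map_add, hx, hy]
  | tmul x y =>
    rw [LinearMap.rTensor_tmul, TensorProduct.map_tmul, ← hF, LinearMap.mul'_apply]
    generalize Δ x = t
    induction t with
    | zero => simp
    | add x y hx hy => simp only [TensorProduct.add_tmul, add_mul, map_add, hx, hy]
    | tmul x z => simp [mul_assoc]

theorem mul'_map_comul {Δ : H →ₗ[k] H ⊗[k] H} {f g h F : H →ₗ[k] k}
    (hF : ∀ x, LinearMap.mul' k k (TensorProduct.map g h (Δ x)) = F x) (t : H ⊗[k] H) :
    LinearMap.mul' k k (TensorProduct.map f (LinearMap.mul' k k ∘ₗ TensorProduct.map g h)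
      (Δ.lTensor H t)) = LinearMap.mul' k k (TensorProduct.map f F t) := by
  induction t with
  | zero => simp
  | add x y hx hy => simp only [map_add, hx, hy]
  | tmul x y => simp [hF]

theorem mul'_map_mul'_assoc (S : H →ₗ[k] H) (t : (H ⊗[k] H) ⊗[k] H) :
    LinearMap.mul' k H (TensorProduct.map (LinearMap.mul' k H ∘ₗ S.rTensor H) S t) =
    LinearMap.mul' k H (TensorProduct.map S (LinearMap.mul' k H ∘ₗ S.lTensor H)
      (TensorProduct.assoc k _ _ _ t)) := by
  induction t with
  | zero => simp
  | add x y hx hy => simp only [map_add, hx, hy]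
  | tmul t z =>
    induction t with
    | zero => simp
    | add x y hx hy => simp only [map_add, TensorProduct.add_tmul, hx, hy]
    | tmul x y => simp [mul_assoc]

theorem map_comul_eq {G : Type*} [AddCommGroup G] [Module k G] {Δ : H →ₗ[k] H ⊗[k] H}
    {S e : H →ₗ[k] H} {F : H →ₗ[k] G}
    (he : ∀ x, LinearMap.mul' k H (S.lTensor H (Δ x)) = e x) (t : H ⊗[k] H) :
    TensorProduct.map F (LinearMap.mul' k H ∘ₗ S.lTensor H) (Δ.lTensor H t) =
    TensorProduct.map F e t := by
  induction t with
  | zero => simp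
  | add x y hx hy => simp only [map_add, hx, hy]
  | tmul x y => simp [he]

/-- `x₁ ⊗ x₂ S(y)` is the image of `x₁ ⊗ (x₂ ⊗ y)`. -/
theorem map_assoc_tmul (S : H →ₗ[k] H) {G : Type*} [AddCommGroup G] [Module k G]
    (F : H →ₗ[k] G) (t : H ⊗[k] H) (y : H) :
    TensorProduct.map F (LinearMap.mul' k H ∘ₗ S.lTensor H)
      (TensorProduct.assoc k _ _ _ (t ⊗ₜ[k] y)) =
    TensorProduct.map F (LinearMap.mulRight k (S y)) t := by
  induction t with
  | zero => simp
  | add x y hx hy => simp only [map_add, TensorProduct.add_tmul, hx, hy]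
  | tmul x z => simp

end TensorIdentities

/-! ### The weak Hopf algebra A -/

namespace StronglySeparableExt

variable {ι : N →ₐ[k] M} {X : StronglySeparableExt ι} {T : N →ₗ[k] k}

namespace DepthTwoData

variable (D : X.DepthTwoData T)

/-- Paired with c, c', c'', the two sides become the two bracketings of a triple `star` product. -/
theorem coassoc (a : centA ι) : TensorProduct.assoc k (centA ι) (centA ι) (centA ι)
    (D.delta.rTensor (centA ι) (D.delta a)) = D.delta.lTensor (centA ι) (D.delta a) := by
  refine D.tensor_ext fun c => D.tensor_ext₂ fun c' c'' => ?_
  have h := (mul'_map_assoc_comul (h := D.pair c'') (fun x => D.pair_delta x c c')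
    (D.delta a)).trans (Eq.trans (by rw [pair_delta, pair_delta, star_assoc])
      (mul'_map_comul (f := D.pair c) (fun x => D.pair_delta x c' c'') (D.delta a)).symm)
  rwa [mul'_map_pair, mul'_map_pair] at h

theorem targetCounit_eq (a : centA ι) : TensorProduct.lid k (centA ι)
    (D.eps.rTensor (centA ι) (D.delta 1 * (a ⊗ₜ[k] 1))) = lA (atOne a) := by
  rw [delta_one, lid_proj_target]

theorem mul_anti' (a : centA ι) : LinearMap.mul' k (centA ι)
    (D.anti.lTensor (centA ι) (D.delta a)) = (lA ∘ₗ atOne) a := D.mul_anti a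

/-- The weak Hopf algebra structure on `A`. -/
noncomputable abbrev weakHopf : WeakHopfAlgebra k (centA ι) where
  comul := D.delta
  counit := D.eps
  coassoc := LinearMap.ext D.coassoc
  rTensor_counit_comp_comul := LinearMap.ext fun a => (TensorProduct.lid k (centA ι)).injective <| by
    simp [lid_eps_delta]
  lTensor_counit_comp_comul := LinearMap.ext fun a => (TensorProduct.rid k (centA ι)).injective <| by
    simp [rid_eps_delta]
  antipode := D.anti
  comul_mul := D.delta_mul
  counit_mul_mul := D.eps_mul_mul
  counit_mul_mul' := D.eps_mul_mul'
  comul_one := by rw [delta_one, delta_proj]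
  comul_one' := by rw [delta_one, delta_proj']
  mul_antipode a := (D.mul_anti a).trans (D.targetCounit_eq a).symm
  antipode_mul a := by
    refine (D.anti_mul a).trans ?_
    rw [← rid_proj_source, ← delta_one]
    rfl
  antipode_mul_antipode a := by
    -- Regroup S(a₁)a₂S(a₃) as S(a₁)ε_t(a₂).
    refine (mul'_map_mul'_assoc D.anti _).trans ?_
    rw [coassoc, map_comul_eq D.mul_anti', anti_mul_target]

theorem weakHopf_targetCounit (a : centA ι) :
    letI := D.weakHopf
    targetCounit k (centA ι) a = lA (atOne a) := D.targetCounit_eq a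

/-! ### The action on M -/

/-- The natural action of `A` on `M`. -/
noncomputable def action :
    letI := D.weakHopf
    WeakHopfAction k (centA ι) M :=
  letI := D.weakHopf
  { act := evA.toLinearMap
    one_act := fun m => by simp
    mul_act := fun a b m => by simp
    act_mul := fun a m m' => by
      have key : ∀ t : centA ι ⊗[k] centA ι, LinearMap.mul' k M
          (TensorProduct.map (evA.toLinearMap.flip m) (evA.toLinearMap.flip m') t) =
          (gamma t m).val m' := by
        intro t
        induction t with
        | zero => simp
        | add x y hx hy => simp only [map_add, LinearMap.add_apply, hx, hy]
        | tmul x y => rfl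
      refine Eq.trans ?_ (key _).symm
      change _ = (gamma (D.delta a) m).val m'
      -- The module algebra rule is a·m = a₁(m)a₂ applied to m'.
      rw [gamma_delta]
      rfl
    act_one := fun a => by
      rw [weakHopf_targetCounit]
      simp }

/-- In M₁, a₁ m S(a₂) = a₁(m) a₂ S(a₃) = a₁(m) ε_t(a₂) = a₁(m) a₂(1), which is the value of a·m at
1. -/
theorem adjointAct_eq (a : centA ι) (m : M) :
    letI := D.weakHopf
    adjointAct ι a m = leftMul ι (evA a m) := by
  let := D.weakHopf
  let F : centA ι →ₗ[k] EndRight ι := (leftMul ι).toLinearMap ∘ₗ evA.toLinearMap.flip m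
  let G : EndRight ι ⊗[k] centA ι →ₗ[k] EndRight ι :=
    LinearMap.mul' k (EndRight ι) ∘ₗ (centA ι).val.toLinearMap.lTensor (EndRight ι)
  have h₁ : ∀ t : centA ι ⊗[k] centA ι, LinearMap.mul' k (EndRight ι) (TensorProduct.map
      (LinearMap.mulRight k (leftMul ι m) ∘ₗ (centA ι).val.toLinearMap)
      ((centA ι).val.toLinearMap ∘ₗ D.anti) t) =
      G (TensorProduct.map F (LinearMap.mul' k (centA ι) ∘ₗ D.anti.lTensor (centA ι))
        (TensorProduct.assoc k _ _ _ (D.delta.rTensor (centA ι) t))) := by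
    intro t
    induction t with
    | zero => simp only [LinearMap.map_zero, LinearEquiv.map_zero]
    | add x y hx hy => simp only [LinearMap.map_add, LinearEquiv.map_add, hx, hy]
    | tmul x y =>
      have e := D.gamma_delta x m
      simp only [TensorProduct.map_tmul, LinearMap.mul'_apply, LinearMap.comp_apply,
        LinearMap.mulRight_apply, AlgHom.toLinearMap_apply, Subalgebra.coe_val, ← e,
        LinearMap.rTensor_tmul]
      refine Eq.trans ?_ (congrArg G (map_assoc_tmul D.anti F (D.delta x) y)).symm
      generalize D.delta x = t
      induction t with
      | zero => simp
      | add x y hx hy => simp only [map_add, LinearMap.add_apply, add_mul, hx, hy]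
      | tmul x z => simp [F, G, mul_assoc]
  have h₂ : ∀ t : centA ι ⊗[k] centA ι, G (TensorProduct.map F (lA ∘ₗ atOne) t) =
      leftMul ι ((gamma t m).val 1) := by
    intro t
    induction t with
    | zero => simp
    | add x y hx hy => simp only [map_add, LinearMap.add_apply, hx, hy]
    | tmul x y =>
      change leftMul ι (evA x m) * leftMul ι (evA y 1) = leftMul ι (evA x m * evA y 1)
      rw [map_mul]
  refine (h₁ (D.delta a)).trans ?_
  rw [coassoc, map_comul_eq D.mul_anti', h₂, gamma_delta, EndRight.val_mul_apply, leftMul_apply,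
    mul_one, evA_def]

theorem leftMul_one_apply (s : EndRight ι) (h : s ∈ centA ι) (u : M) (hu : leftMul ι u = s) :
    evA (⟨s, h⟩ : centA ι) 1 = u := by
  subst hu
  exact mul_one u

/-! ### The smash product isomorphism -/

/-- The map `m # a ↦ m a` from the smash product to `M₁`. -/
noncomputable def smashHom :
    letI := D.weakHopf
    SmashProduct D.action →ₗ[k] EndRight ι :=
  letI := D.weakHopf
  (smashRel D.action).liftQ (LinearMap.mul' k (EndRight ι) ∘ₗ
    TensorProduct.map (leftMul ι).toLinearMap (centA ι).val.toLinearMap) (by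
      rw [smashRel, Submodule.span_le]
      rintro _ ⟨m, z, h, hz, rfl⟩
      -- An element z of A_t equals L_{z(1)}, so m(z · 1)h and m(zh) agree in M₁.
      rw [weakHopf_targetCounit] at hz
      change _ = _
      rw [map_sub, sub_eq_zero]
      conv_rhs => rw [← hz]
      simp only [LinearMap.comp_apply, TensorProduct.map_tmul, LinearMap.mul'_apply,
        AlgHom.toLinearMap_apply, map_mul, Subalgebra.coe_val, coe_lA, mul_assoc]
      rfl)

theorem smashHom_mk (m : M) (a : centA ι) :
    letI := D.weakHopf
    D.smashHom (SmashProduct.mk D.action m a) = leftMul ι m * (a : EndRight ι) := rfl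

theorem smashHom_proj (t : M ⊗[k] centA ι) :
    letI := D.weakHopf
    D.smashHom (SmashProduct.proj D.action t) = LinearMap.mul' k (EndRight ι)
      (TensorProduct.map (leftMul ι).toLinearMap (centA ι).val.toLinearMap t) := rfl

/-- The map `s ↦ ∑ E_M(s z_i) # w_i` from `M₁` to the smash product. -/
noncomputable def smashInv :
    letI := D.weakHopf
    EndRight ι →ₗ[k] SmashProduct D.action :=
  letI := D.weakHopf
  SmashProduct.proj D.action ∘ₗ ∑ i, (TensorProduct.mk k M (centA ι)).flip (D.w i) ∘ₗ
    X.basic.E ∘ₗ LinearMap.mulRight k (D.z i : EndRight ι)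

theorem smashInv_apply (s : EndRight ι) :
    letI := D.weakHopf
    D.smashInv s = ∑ i, SmashProduct.mk D.action (X.basic.E (s * D.z i)) (D.w i) := by
  simp [smashInv, SmashProduct.mk]

/-- `M # A ≃ M₁` -/
noncomputable def smashEquiv :
    letI := D.weakHopf
    SmashProduct D.action ≃ₐ[k] EndRight ι :=
  letI := D.weakHopf
  AlgEquiv.ofLinearEquiv
    (LinearEquiv.ofLinearMap D.smashHom D.smashInv
      (LinearMap.ext fun s => by
        rw [LinearMap.comp_apply, smashInv_apply, map_sum]
        exact D.dual_left s)
      (LinearMap.ext fun x => by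
        obtain ⟨t, rfl⟩ := SmashProduct.proj_surjective D.action x
        induction t with
        | zero => simp
        | add x y hx hy => simp only [map_add, hx, hy]
        | tmul m a =>
          -- The coefficient E_M(a z_i) ∈ U crosses the tensor sign by the smash relation; then ∑
          -- E_M(a z_i) w_i = a.
          have h := fun i => SmashProduct.proj_rel D.action m (z := lA (X.EU (a * D.z i)))
            (by rw [weakHopf_targetCounit]; congr 1; exact Subtype.ext (by simp)) (D.w i)
          have e : ∀ i, X.basic.E (leftMul ι m * (a : EndRight ι) * D.z i) =
              m * D.action.act (lA (X.EU (a * D.z i))) 1 := fun i => by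
            rw [mul_assoc, X.basic.E_left]
            exact congrArg (m * ·) (mul_one _).symm
          change D.smashInv (D.smashHom (SmashProduct.mk D.action m a)) = _
          rw [smashHom_mk, smashInv_apply]
          simp only [e, SmashProduct.mk, h]
          rw [← map_sum, ← TensorProduct.tmul_sum, sum_EU]
          rfl))
    (by
      change D.smashHom (SmashProduct.mk D.action 1 1) = 1
      rw [smashHom_mk]; simp)
    (fun x y => by
      change D.smashHom (x * y) = D.smashHom x * D.smashHom y
      obtain ⟨s, rfl⟩ := SmashProduct.proj_surjective D.action x
      obtain ⟨t, rfl⟩ := SmashProduct.proj_surjective D.action y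
      induction s with
      | zero => simp
      | add x y hx hy => simp only [map_add, add_mul, hx, hy]
      | tmul m a =>
        induction t with
        | zero => simp
        | add x y hx hy => simp only [map_add, mul_add, hx, hy]
        | tmul m' a' =>
          have key : ∀ t : centA ι ⊗[k] centA ι, LinearMap.mul' k (EndRight ι)
              (TensorProduct.map (leftMul ι).toLinearMap (centA ι).val.toLinearMap
              (TensorProduct.map (LinearMap.mulLeft k m ∘ₗ D.action.act.flip m')
                (LinearMap.mulRight k a') t)) = leftMul ι m * gamma t m' * a' := by
            intro t
            induction t with
            | zero => simp
            | add x y hx hy => simp only [map_add, LinearMap.add_apply, mul_add, add_mul, hx, hy]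
            | tmul x y => simp [mul_assoc]; rfl
          change D.smashHom (SmashProduct.mk D.action m a * SmashProduct.mk D.action m' a') =
            D.smashHom (SmashProduct.mk D.action m a) * D.smashHom (SmashProduct.mk D.action m' a')
          rw [SmashProduct.mk_mul_mk, smashHom_proj, key, smashHom_mk, smashHom_mk]
          -- Multiplicativity is m a m' a' = m a₁(m') a₂ a'.
          change leftMul ι m * gamma (D.delta a) m' * a' = _
          rw [gamma_delta]
          simp only [mul_assoc])

end DepthTwoData
end StronglySeparableExt

/-! ### The identification of B with A -/

namespace StronglySeparableExt

variable {ι : N →ₐ[k] M} {X : StronglySeparableExt ι} {T : N →ₗ[k] k}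

section CentB

theorem centB_leftMul_mul (b : centB ι) (m : M) (s : EndRight ι) :
    (b : EndRight (leftMul ι)).val (leftMul ι m * s) =
      leftMul ι m * (b : EndRight (leftMul ι)).val s := by
  have h := (Subalgebra.mem_centralizer_iff k).1 b.2 _ ⟨m, rfl⟩
  exact (congrArg (fun f : EndRight (leftMul ι) => f.val s) h).symm

/-- As x e₁ y is the map m ↦ xE(ym), this is the expansion of s(m) in the dual bases. It shows M₁ =
M e₁ M. -/
theorem sum_leftMul_e (s : EndRight ι) :
    ∑ i, leftMul ι (s.val (X.x i)) * X.e * leftMul ι (X.y i) = s :=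
  EndRight.ext fun m => by
    rw [X.apply_eq_sum s m, map_sum, LinearMap.sum_apply]
    rfl

variable (X) in
/-- The map `b ↦ b(e₁)` from `B` to `A`. -/
noncomputable def evE : centB ι →ₗ[k] centA ι where
  toFun b := ⟨(b : EndRight (leftMul ι)).val X.e, mem_cent_iff.2 fun n => by
    have h := mem_cent_iff.1 (X.eA : centA ι).2 n
    rw [coe_eA, AlgHom.comp_apply] at h
    rw [AlgHom.comp_apply, ← centB_leftMul_mul, h, EndRight.val_apply_mul]⟩
  map_add' b b' := Subtype.ext (by simp)
  map_smul' c b := Subtype.ext (by simp)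

theorem coe_evE (b : centB ι) :
    (X.evE b : EndRight ι) = (b : EndRight (leftMul ι)).val X.e := rfl

/-- An element of B is M-linear on both sides, and M₁ = M e₁ M, so it is determined by its value at
e₁. -/
theorem centB_val (b : centB ι) (s : EndRight ι) : (b : EndRight (leftMul ι)).val s =
    ∑ i, leftMul ι (s.val (X.x i)) * (X.evE b : EndRight ι) * leftMul ι (X.y i) := by
  conv_lhs => rw [← X.sum_leftMul_e s, map_sum]
  exact Finset.sum_congr rfl fun i _ => by
    rw [EndRight.val_apply_mul, centB_leftMul_mul, coe_evE]

variable (X) in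
/-- The element `s ↦ ∑ s(x_i) c y_i` of `B`, for `c ∈ A`. -/
noncomputable def ofA (c : centA ι) : centB ι :=
  ⟨⟨{ toFun := fun s => ∑ i, leftMul ι (s.val (X.x i)) * (c : EndRight ι) * leftMul ι (X.y i)
      map_add' := fun s t => by simp [add_mul, Finset.sum_add_distrib]
      map_smul' := fun r s => by simp [Finset.smul_sum] },
    fun s m => by
      have h := X.sum_casimir (fun p q => leftMul ι (s.val p) * (c : EndRight ι) * leftMul ι q) m
        (fun s b => by simp [Finset.sum_mul]) (fun s b => by simp [Finset.mul_sum])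
        (fun p n q => by
          have e := mem_cent_iff.1 c.2 n
          simp only [AlgHom.comp_apply] at e
          simp only [EndRight.val_apply_mul, map_mul, mul_assoc]
          rw [← mul_assoc (leftMul ι (ι n)), e, mul_assoc])
      simp only [LinearMap.coe_mk, AddHom.coe_mk, EndRight.val_mul_apply, leftMul_apply,
        Finset.sum_mul]
      rw [h]
      simp only [map_mul, mul_assoc]⟩,
   mem_cent_iff.2 fun m => EndRight.ext fun s => by
    change leftMul ι m * (∑ i, _) = ∑ i, leftMul ι ((leftMul ι m * s).val (X.x i)) * _ * _
    simp only [EndRight.val_mul_apply, leftMul_apply, map_mul (leftMul ι), Finset.mul_sum,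
      mul_assoc]⟩

theorem evE_ofA (c : centA ι) : X.evE (X.ofA c) = c :=
  centA_ext fun m => by
    change (∑ i, leftMul ι (X.e.val (X.x i)) * (c : EndRight ι) * leftMul ι (X.y i)).val m = _
    simp only [map_sum, LinearMap.sum_apply, EndRight.val_mul_apply, leftMul_apply, e_apply,
      ← evA_def, ← evA_left]
    rw [← map_sum]
    simp only [← mul_assoc]
    rw [← Finset.sum_mul]
    have h := X.dual_left 1
    simp only [one_mul] at h
    rw [h, one_mul]

theorem evE_injective : Function.Injective (X.evE : centB ι → centA ι) := fun b b' h =>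
  Subtype.ext (EndRight.ext fun s => by rw [centB_val (X := X), centB_val (X := X), h])

variable (X) in
/-- The bijection `b ↦ b(e₁)` from `B` to `A`. -/
noncomputable def evEquiv : centB ι ≃ₗ[k] centA ι :=
  LinearEquiv.ofBijective X.evE ⟨evE_injective, fun c => ⟨X.ofA c, evE_ofA c⟩⟩

theorem evEquiv_apply (b : centB ι) : X.evEquiv b = X.evE b := rfl

/-- The origin of `star`: expand b(b'(e₁)) by `centB_val`. -/
theorem evE_mul (b b' : centB ι) :
    X.evE (b * b') = DepthTwoData.star X (X.evE b) (X.evE b') :=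
  centA_ext fun m => by
    have h := centB_val (X := X) b (X.evE b')
    rw [evA_def, coe_evE, Subalgebra.coe_mul, EndRight.val_mul_apply, ← coe_evE, h,
      DepthTwoData.evA_star, map_sum, LinearMap.sum_apply]
    rfl

theorem evE_one : X.evE 1 = X.eA := rfl

end CentB

/-! ### The pairing and the antipode of B in terms of A -/

namespace DepthTwoData

variable (D : X.DepthTwoData T)

/-- The trace property brings first e₂, then e₁ to the right end, where E_{M₁}(f e₂) = λf(1) and
E_M(f e₁) = λf(1); the two factors λ cancel λ⁻². -/
theorem pairing_eq (hw : (X.w T : EndRight ι) = (rA D.d : centA ι)) (a : centA ι) (b : centB ι) :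
    X.pairing T a b = D.pair (X.evE b) a := by
  have h : X.pairing T a b = X.lam⁻¹ ^ 2 * X.trace₂ T ((b : EndRight (leftMul ι)) *
      leftMul (leftMul ι) a * X.basic.e * leftMul (leftMul ι) (X.e * X.w T)) := by
    change _ * X.trace₂ T _ = _
    rw [D.markov.trace₂_comm, map_mul (leftMul (leftMul ι))]
    simp only [mul_assoc]
  have h₂ : X.trace₂ T ((b : EndRight (leftMul ι)) *
      leftMul (leftMul ι) a * X.basic.e * leftMul (leftMul ι) (X.e * X.w T)) =
      X.lam * X.trace₁ T ((b : EndRight (leftMul ι)).val a * (X.e * X.w T)) := by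
    change X.trace₁ T (X.basic.basic.E _) = _
    rw [X.basic.basic.E_right, basic_E_mul_e, EndRight.val_mul_apply, leftMul_apply, mul_one,
      smul_mul_assoc, map_smul, smul_eq_mul]
    rfl
  rw [h, h₂, ← mul_assoc _ X.e, D.markov.trace₁_comm, ← mul_assoc (X.w T : EndRight ι), trace₁_apply, basic_E_mul_e,
    map_smul, smul_eq_mul, pair_apply, hw, centB_val (X := X), EndRight.val_mul_apply, ← evA_def,
    evA_rA, map_sum, LinearMap.sum_apply, Finset.sum_mul]
  simp only [EndRight.val_mul_apply, leftMul_apply, mul_one, ← evA_def]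
  rw [← mul_assoc, ← mul_assoc]
  have e : X.lam⁻¹ ^ 2 * X.lam * X.lam = 1 := by
    field_simp [X.lam_ne_zero]
  rw [e, one_mul]

/-- Only e₂ is removed, so a single factor λ⁻¹ remains. This puts the defining formula of S_B in
terms of T₁ on A. -/
theorem trace₂_eq (hw : (X.w T : EndRight ι) = (rA D.d : centA ι)) (a : centA ι) (b : centB ι) :
    X.lam⁻¹ ^ 2 * X.trace₂ T ((b : EndRight (leftMul ι)) * leftMul (leftMul ι) X.e *
        X.basic.e * leftMul (leftMul ι) (X.w T) * leftMul (leftMul ι) a) =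
      X.lam⁻¹ * X.trace₁ T (rA D.d * a * X.evE b : centA ι) := by
  have h : X.trace₂ T ((b : EndRight (leftMul ι)) * leftMul (leftMul ι) X.e *
        X.basic.e * leftMul (leftMul ι) (X.w T) * leftMul (leftMul ι) a) =
      X.lam * X.trace₁ T (rA D.d * a * X.evE b : centA ι) := by
    rw [mul_assoc _ (leftMul (leftMul ι) (X.w T : EndRight ι)), D.markov.trace₂_comm, ← mul_assoc,
      ← mul_assoc]
    change X.trace₁ T (X.basic.basic.E _) = _
    rw [basic_E_mul_e, map_smul, smul_eq_mul, hw]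
    simp only [EndRight.val_mul_apply, leftMul_apply, mul_one, ← coe_evE, Subalgebra.coe_mul]
    rfl
  rw [h, ← mul_assoc]
  congr 1
  field_simp [X.lam_ne_zero]

/-- The bijection of `A` that corresponds to the antipode of `B`. -/
noncomputable def antiB : centA ι ≃ₗ[k] centA ι :=
  LinearEquiv.ofLinearMap (LinearMap.mulRight k (lA D.d * rA D.d') ∘ₗ X.und)
    (X.bar ∘ₗ LinearMap.mulRight k (lA D.d' * rA D.d))
    (LinearMap.ext fun c => by
      have h : lA D.d' * rA D.d * (lA D.d * rA D.d') = (1 : centA ι) := by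
        rw [mul_assoc, rA_mul_lA_mul, ← mul_assoc, ← lA_mul, ← rA_mul, D.d'_mul, lA_one, rA_one,
          one_mul]
      simp only [LinearMap.comp_apply, LinearMap.mulRight_apply, und_bar]
      rw [mul_assoc, h, mul_one, LinearMap.id_apply])
    (LinearMap.ext fun c => by
      have h : lA D.d * rA D.d' * (lA D.d' * rA D.d) = (1 : centA ι) := by
        rw [mul_assoc, rA_mul_lA_mul, ← mul_assoc, ← lA_mul, ← rA_mul, D.d_mul, lA_one, rA_one,
          one_mul]
      simp only [LinearMap.comp_apply, LinearMap.mulRight_apply]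
      rw [mul_assoc, h, mul_one, bar_und, LinearMap.id_apply])

theorem antiB_apply (c : centA ι) : D.antiB c = X.und c * (lA D.d * rA D.d') := rfl

theorem pair_eq_antiB (a c : centA ι) :
    D.pair c a = X.lam⁻¹ * X.trace₁ T (rA D.d * a * D.antiB c : centA ι) := by
  rw [pair_eq, antiB_apply]
  congr 1
  have h : rA D.d * a * (X.und c * (lA D.d * rA D.d')) =
      rA D.d * (a * X.und c * lA D.d * rA D.d') := by simp only [mul_assoc]
  rw [h, D.trace₁_comm (rA D.d), mul_assoc _ (rA D.d'), ← rA_mul, D.d_mul, rA_one, mul_one,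
    D.trace₁_comm]

/-- Apply T₁(ā) = T₁(a) to the right-hand side: `bar` cancels the `und` in `antiB`, and a cyclic
permutation gives the left-hand side. -/
theorem pair_anti (a c : centA ι) : D.pair c (D.anti a) = D.pair (D.antiB c) a := by
  rw [pair_eq, pair_eq, ← D.trace₁_bar (lA D.d * (a * X.und (D.antiB c)))]
  congr 1
  rw [bar_mul, bar_mul, bar_und, antiB_apply, bar_lA, anti_apply, D.trace₁_comm (lA D.d)]
  simp only [mul_assoc, D.trace₁_comm (X.und c)]
  rw [D.trace₁_comm (lA D.d)]
  simp only [mul_assoc]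

end DepthTwoData
end StronglySeparableExt

/-! ### Non-degenerate traces on Kanzaki separable algebras -/

section Separable

variable {R : Type*} [Ring R] [Algebra k R]

theorem IsSymmSepElement.comm_mul {f : R ⊗[k] R} (hf : IsSymmSepElement k f) (r : R) :
    (1 ⊗ₜ[k] r) * f = f * (r ⊗ₜ[k] 1) := by
  have := congrArg (Algebra.TensorProduct.comm k R R) (hf.2.2 r)
  have hc : Algebra.TensorProduct.comm k R R f = f := hf.2.1
  simpa [hc] using this

/-- Functionals `T(· r)` with `T` non-degenerate separate the elements of `R ⊗ R`. -/
theorem eq_zero_of_lTensor (T : R →ₗ[k] k) (hT : ∀ u, (∀ r, T (u * r) = 0) → u = 0)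
    {t : R ⊗[k] R}
    (ht : ∀ r, TensorProduct.rid k R ((T ∘ₗ LinearMap.mulRight k r).lTensor R t) = 0) :
    t = 0 := by
  let b := Module.Basis.ofVectorSpace k R
  obtain ⟨c, rfl⟩ := TensorProduct.eq_repr_basis_left b t
  have hc : ∀ i, c i = 0 := fun i => hT _ fun r => by
    have h := congrArg (fun v => b.repr v i) (ht r)
    simp only [Finsupp.sum, map_sum, LinearMap.lTensor_tmul, TensorProduct.rid_tmul, map_smul,
      LinearMap.comp_apply, LinearMap.mulRight_apply, Finsupp.finsetSum_apply,
      Module.Basis.repr_self, Finsupp.smul_apply, smul_eq_mul, map_zero, Finsupp.zero_apply] at h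
    rw [Finset.sum_eq_single i] at h
    · simpa using h
    · intro j _ hj
      simp [hj]
    · intro hi
      simp [Finsupp.notMem_support_iff.1 hi]
  have : c = 0 := Finsupp.ext hc
  simp [this]

/-- The central invertible element `∑ T(f₂) f₁`, where `f` is a symmetric separability element
and `T` is a non-degenerate trace. -/
theorem IsSymmSepElement.exists_inverse (T : R →ₗ[k] k)
    (hT : ∀ u, (∀ r, T (u * r) = 0) → u = 0) (hT' : ∀ u v, T (u * v) = T (v * u)) {m : ℕ}
    (p q : Fin m → R) (hf : IsSymmSepElement k (∑ j, p j ⊗ₜ[k] q j)) :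
    ∃ d d' : R, d' = ∑ j, T (q j) • p j ∧ d * d' = 1 ∧ (∀ u, d * u = u * d) ∧
      (∀ u, ∑ j, T (q j * u * d) • p j = u) ∧ ∀ u, ∑ j, T (p j * u * d) • q j = u := by
  set z := ∑ j, T (q j) • p j with hz
  have h₁ : ∀ u, ∑ j, T (q j * u) • p j = u * z := fun u => by
    have h := congrArg (fun t => TensorProduct.rid k R (T.lTensor R t)) (hf.2.2 u)
    simp only [Finset.mul_sum, Finset.sum_mul, Algebra.TensorProduct.tmul_mul_tmul, map_sum,
      LinearMap.lTensor_tmul, TensorProduct.rid_tmul, mul_one, one_mul] at h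
    rw [← h, hz, Finset.mul_sum]
    simp
  have h₂ : ∀ u, ∑ j, T (q j * u) • p j = z * u := fun u => by
    have h := congrArg (fun t => TensorProduct.rid k R (T.lTensor R t)) (hf.comm_mul u)
    simp only [Finset.mul_sum, Finset.sum_mul, Algebra.TensorProduct.tmul_mul_tmul, map_sum,
      LinearMap.lTensor_tmul, TensorProduct.rid_tmul, mul_one, one_mul] at h
    simp only [hT' (q _) u]
    rw [h, hz, Finset.sum_mul]
    simp
  have h₃ : ∀ u, ∑ j, T (p j * u) • q j = u * z := fun u => by
    have h := congrArg (fun t => TensorProduct.rid k R ((T ∘ₗ LinearMap.mulRight k u).lTensor R t))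
      hf.2.1
    simp only [map_sum, LinearMap.lTensor_tmul, TensorProduct.rid_tmul, TensorProduct.comm_tmul,
      LinearMap.comp_apply, LinearMap.mulRight_apply] at h
    rw [h, h₁]
  -- If uz = 0, every functional T(· r) kills ∑ p_j ⊗ q_j u, since the result is urz = uzr. By
  -- non-degeneracy this tensor is 0, and multiplying out gives u = 0.
  have hinj : ∀ u, u * z = 0 → u = 0 := fun u hu => by
    have h := eq_zero_of_lTensor T hT (t := ∑ j, p j ⊗ₜ[k] (q j * u)) fun r => by
      simp only [map_sum, LinearMap.lTensor_tmul, TensorProduct.rid_tmul,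
        LinearMap.comp_apply, LinearMap.mulRight_apply, mul_assoc]
      rw [h₁, mul_assoc, ← h₁, h₂, ← mul_assoc, hu, zero_mul]
    have h' := congrArg (LinearMap.mul' k R) h
    have h1 := hf.1
    simp only [map_sum, LinearMap.mul'_apply] at h1
    simpa only [map_sum, LinearMap.mul'_apply, ← mul_assoc, ← Finset.sum_mul, h1, one_mul,
      map_zero] using h'
  -- The injective map u ↦ uz lands in the span of the p_j, so R is finite-dimensional and the map
  -- is also surjective; d is the inverse of z.
  have hfin : Module.Finite k R := by
    let S := Submodule.span k (Set.range p)
    have : FiniteDimensional k S := FiniteDimensional.span_of_finite k (Set.finite_range p)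
    let g : R →ₗ[k] S := (LinearMap.mulRight k z).codRestrict S fun u => by
      rw [LinearMap.mulRight_apply, ← h₁]
      exact Submodule.sum_mem _ fun j _ =>
        Submodule.smul_mem _ _ (Submodule.subset_span ⟨j, rfl⟩)
    refine Module.Finite.of_injective g ((injective_iff_map_eq_zero g).2 fun u hu => hinj u ?_)
    exact congrArg Subtype.val hu
  have hsurj : Function.Surjective (LinearMap.mulRight k z) :=
    LinearMap.injective_iff_surjective.1 ((injective_iff_map_eq_zero _).2 hinj)
  obtain ⟨d, hd⟩ := hsurj 1
  rw [LinearMap.mulRight_apply] at hd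
  have hz' : ∀ u, u * z = z * u := fun u => by rw [← h₁, h₂]
  refine ⟨d, z, rfl, hd, fun u => ?_, fun u => ?_, fun u => ?_⟩
  · calc d * u = d * (u * (z * d)) := by rw [← hz', hd, mul_one]
      _ = u * d := by rw [← mul_assoc u, hz', ← mul_assoc, ← mul_assoc, hd, one_mul]
  · simp only [mul_assoc, h₁, hd, mul_one]
  · simp only [mul_assoc, h₃, hd, mul_one]

end Separable

/-! ### From the hypotheses to the depth 2 data; duality and uniqueness -/

namespace StronglySeparableExt

variable {ι : N →ₐ[k] M} {X : StronglySeparableExt ι} {T : N →ₗ[k] k}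

theorem phi_eq (u : cent ι) : X.phi u = (rA u : centA ι) :=
  EndRight.ext fun m => by
    simp only [phi, map_sum, LinearMap.sum_apply, EndRight.val_mul_apply, leftMul_apply, e_apply,
      mul_assoc]
    simp only [← cent_comm, ← mul_assoc]
    rw [← Finset.sum_mul, X.dual_right]
    rfl

/-- Under the first alternative T₁(R_u) = λT₀(u ∑ y_i x_i) = T₀(u); the second is the claim itself,
as R_u = ∑ x_i u e₁ y_i. -/
theorem trace₁_rA (hT : X.IsMarkovTrace T)
    (hprod : ∑ i, X.y i * X.x i = algebraMap k M X.lam⁻¹ ∨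
      ∀ u ∈ cent ι, X.trace₁ T (X.phi u) = X.trace₀ T u) (u : cent ι) :
    X.trace₁ T (rA u : centA ι) = X.trace₀ T u := by
  obtain h | h := hprod
  · rw [trace₁_apply, DepthTwoData.basic_E_rA, map_smul, map_sum]
    simp only [hT.trace₀_comm (X.x _), mul_assoc]
    rw [← map_sum, ← Finset.mul_sum, h, Algebra.algebraMap_eq_smul_one, mul_smul_comm, mul_one,
      map_smul, smul_smul, mul_inv_cancel₀ X.lam_ne_zero, one_smul]
  · rw [← phi_eq, h u u.2]

theorem leftMul_mul_centV (v : centV ι) (m : M) : (v : EndRight ι).val m =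
    m * (v : EndRight ι).val 1 := by
  have h := (Subalgebra.mem_centralizer_iff k).1 v.2 _ ⟨m, rfl⟩
  have h' := congrArg (fun f : EndRight ι => f.val 1) h
  simp only [EndRight.val_mul_apply, leftMul_apply, mul_one] at h'
  exact h'.symm

/-- The anti-isomorphism `u ↦ R_u` from `U` to `V`. -/
noncomputable def rV : cent ι →ₗ[k] centV ι where
  toFun u := ⟨(rA u : centA ι), mem_cent_iff.2 fun m => (rA_leftMul_comm u m).symm⟩
  map_add' u v := Subtype.ext (by simp)
  map_smul' c u := Subtype.ext (by simp)

theorem coe_rV (u : cent ι) : (rV u : EndRight ι) = (rA u : centA ι) := rfl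

theorem rV_mul (u v : cent ι) : rV (u * v) = rV v * rV u :=
  Subtype.ext (by rw [coe_rV, rA_mul]; rfl)

theorem rV_one : rV (1 : cent ι) = 1 := Subtype.ext (by rw [coe_rV, rA_one]; rfl)

theorem rV_surjective : Function.Surjective (rV : cent ι → centV ι) := fun v =>
  ⟨⟨(v : EndRight ι).val 1, mem_cent_iff.2 fun n => by
    have h := (v : EndRight ι).val_apply_mul 1 n
    rw [one_mul, leftMul_mul_centV] at h
    exact h⟩, Subtype.ext (EndRight.ext fun m => (leftMul_mul_centV v m).symm)⟩

/-- The bijection u ↦ R_u reverses products, and the symmetry of f compensates for this. -/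
theorem symmSepElement_centV {f : cent ι ⊗[k] cent ι} (hf : IsSymmSepElement k f) :
    symmSepElement k (centV ι) = TensorProduct.map rV rV f := by
  have h : IsSymmSepElement k (TensorProduct.map (rV (ι := ι)) rV f) := by
    refine ⟨?_, ?_, fun r => ?_⟩
    · have e : ∀ t : cent ι ⊗[k] cent ι, LinearMap.mul' k (centV ι) (TensorProduct.map rV rV t) =
          rV (LinearMap.mul' k _ (TensorProduct.comm k _ _ t)) := by
        intro t
        induction t with
        | zero => simp
        | add x y hx hy => simp only [map_add, hx, hy]
        | tmul x y => simp [rV_mul]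
      rw [e, hf.2.1, hf.1, rV_one]
    · rw [← TensorProduct.map_comm, hf.2.1]
    · obtain ⟨u, rfl⟩ := rV_surjective r
      have e₁ : ∀ t : cent ι ⊗[k] cent ι, (rV u ⊗ₜ[k] 1) * TensorProduct.map rV rV t =
          TensorProduct.map rV rV (t * (u ⊗ₜ[k] 1)) := by
        intro t
        induction t with
        | zero => simp
        | add x y hx hy => simp only [map_add, mul_add, add_mul, hx, hy]
        | tmul x y => simp [rV_mul]
      have e₂ : ∀ t : cent ι ⊗[k] cent ι, TensorProduct.map rV rV t * (1 ⊗ₜ[k] rV u) =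
          TensorProduct.map rV rV ((1 ⊗ₜ[k] u) * t) := by
        intro t
        induction t with
        | zero => simp
        | add x y hx hy => simp only [map_add, mul_add, add_mul, hx, hy]
        | tmul x y => simp [rV_mul]
      rw [e₁, e₂, hf.comm_mul]
  exact (Classical.epsilon_spec (p := fun f => IsSymmSepElement k f) ⟨_, h⟩).unique h

/-- The weight d is the inverse of ∑ T₀(q_j)p_j. Since T₁(R_u) = T₀(u), the map u ↦ R_u carries that
sum to f⁽¹⁾T₁(f⁽²⁾), whence w = R_d. -/
theorem exists_depthTwoData (hT : X.IsMarkovTrace T) (hsymm : X.IsSymmetric)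
    (hprod : ∑ i, X.y i * X.x i = algebraMap k M X.lam⁻¹ ∨
      ∀ u ∈ cent ι, X.trace₁ T (X.phi u) = X.trace₀ T u)
    (hU : IsKanzakiSeparable k (cent ι))
    (hT₀ : ∀ u ∈ cent ι, (∀ u' ∈ cent ι, X.trace₀ T (u * u') = 0) → u = 0)
    (hdepth : X.HasDepthTwo) :
    ∃ D : X.DepthTwoData T, (X.w T : EndRight ι) = (rA D.d : centA ι) := by
  obtain ⟨f, hf⟩ := hU
  obtain ⟨m, p, q, rfl⟩ := TensorProduct.exists_sum_tmul_eq f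
  obtain ⟨⟨n, z, w, hz, hw, hzw⟩, -⟩ := hdepth
  obtain ⟨d, d', hd', hdd', hd, hp, hq⟩ := hf.exists_inverse
    (X.trace₀ T ∘ₗ (cent ι).val.toLinearMap)
    (fun u h => Subtype.ext (hT₀ u u.2 fun u' hu' => h ⟨u', hu'⟩))
    (fun u v => hT.trace₀_comm _ _) p q
  have h1 := hf.1
  have h2 := hf.2.2
  simp only [map_sum, LinearMap.mul'_apply] at h1
  simp only [Finset.mul_sum, Finset.sum_mul, Algebra.TensorProduct.tmul_mul_tmul, mul_one,
    one_mul] at h2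
  refine ⟨⟨hT, hsymm, trace₁_rA hT hprod, n, fun i => ⟨z i, hz i⟩, fun i => ⟨w i, hw i⟩,
    fun s => (hzw s).1, fun s => (hzw s).2, m, p, q, h1, h2, d, d', hdd', hd, hp, hq⟩, ?_⟩
  change (X.w T : EndRight ι) = rV d
  congr 1
  have e : TensorProduct.rid k (centV ι)
      ((X.trace₁ T ∘ₗ (centV ι).val.toLinearMap).lTensor (centV ι) (symmSepElement k (centV ι))) =
      rV d' := by
    rw [symmSepElement_centV hf, hd']
    simp only [map_sum, TensorProduct.map_tmul, LinearMap.lTensor_tmul, TensorProduct.rid_tmul,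
      LinearMap.comp_apply, AlgHom.toLinearMap_apply, Subalgebra.coe_val, coe_rV,
      trace₁_rA hT hprod, map_smul]
  have e₁ : rV d * rV d' = (1 : centV ι) := by rw [← rV_mul, ← hd, hdd', rV_one]
  have e₂ : rV d' * rV d = (1 : centV ι) := by rw [← rV_mul, hdd', rV_one]
  rw [StronglySeparableExt.w, e]
  exact Ring.inverse_unit (⟨rV d', rV d, e₂, e₁⟩ : (centV ι)ˣ)

theorem DepthTwoData.isDualStructure (D : X.DepthTwoData T)
    (hw : (X.w T : EndRight ι) = (rA D.d : centA ι)) : X.IsDualStructure T D.weakHopf where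
  comul a b b' := by
    have e : ∀ b, (X.pairing T).flip b = D.pair (X.evE b) := fun b =>
      LinearMap.ext fun a => D.pairing_eq hw a b
    rw [e, e, D.pairing_eq hw, evE_mul]
    exact D.pair_delta _ _ _
  counit a := by
    rw [D.pairing_eq hw, evE_one, D.pair_apply]
    change X.trace₀ T (evA a 1 * D.d) = _
    -- The unit of B corresponds to e₁, and ∑ a(x_i)E(y_i) = a(∑ x_i E(y_i)) = a(1).
    have h := X.dual_right 1
    simp only [mul_one] at h
    simp only [← Finset.sum_mul, evA_eA, ← evA_right]
    rw [← map_sum, h]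
  antipode := by
    refine ⟨X.evEquiv.trans (D.antiB.trans X.evEquiv.symm), fun a b => ?_, fun a b => ?_⟩
    · rw [D.trace₂_eq hw, D.pairing_eq hw, ← evEquiv_apply, ← evEquiv_apply]
      simp only [LinearEquiv.trans_apply, LinearEquiv.apply_symm_apply]
      rw [← D.pair_eq_antiB]
    · rw [D.pairing_eq hw, D.pairing_eq hw, ← evEquiv_apply, ← evEquiv_apply]
      simp only [LinearEquiv.trans_apply, LinearEquiv.apply_symm_apply]
      exact D.pair_anti _ _

/-- The pairing separates points of A and of A ⊗ A, and S_B is itself unique: its defining formula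
fixes T₁ of all products with S_B(b)(e₁). -/
theorem DepthTwoData.isDualStructure_unique (D : X.DepthTwoData T)
    (hw : (X.w T : EndRight ι) = (rA D.d : centA ι)) {W W' : WeakHopfAlgebra k (centA ι)}
    (hW : X.IsDualStructure T W) (hW' : X.IsDualStructure T W') : W = W' := by
  have e : ∀ c, (X.pairing T).flip (X.evEquiv.symm c) = D.pair c := fun c =>
    LinearMap.ext fun a => by
      rw [LinearMap.flip_apply, D.pairing_eq hw, ← evEquiv_apply, LinearEquiv.apply_symm_apply]
  refine WeakHopfAlgebra.ext_of_eq (LinearMap.ext fun a => D.tensor_ext₂ fun c c' => ?_)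
    (LinearMap.ext fun a => (hW.counit a).trans (hW'.counit a).symm)
    (LinearMap.ext fun a => D.eq_of_pair fun c => ?_)
  · rw [← e, ← e, hW.comul, hW'.comul]
  · obtain ⟨S, hS, hS'⟩ := hW.antipode
    obtain ⟨R, hR, hR'⟩ := hW'.antipode
    rw [← e, LinearMap.flip_apply, LinearMap.flip_apply, hS', hR']
    congr 1
    generalize X.evEquiv.symm c = b
    apply X.evEquiv.injective
    refine D.eq_of_trace₁ fun a' => ?_
    -- The choice a = R_{d'}a' cancels the factor R_d = w of the formula.
    have h := (hS (rA D.d' * a') b).symm.trans (hR (rA D.d' * a') b)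
    rw [D.trace₂_eq hw, D.trace₂_eq hw, ← mul_assoc (rA D.d), ← rA_mul, D.d'_mul, rA_one, one_mul,
      D.trace₁_comm a', D.trace₁_comm a'] at h
    exact mul_left_cancel₀ (inv_ne_zero X.lam_ne_zero) h

end StronglySeparableExt

end

/-! ### The main theorem -/

theorem mainTheorem2 {k N M : Type*} [Field k] [Ring N] [Ring M] [Algebra k N] [Algebra k M]
    (ι : N →ₐ[k] M) (X : StronglySeparableExt ι) (T : N →ₗ[k] k)
    (hT : X.IsMarkovTrace T) (hsymm : X.IsSymmetric)
    (hprod : ∑ i, X.y i * X.x i = algebraMap k M X.lam⁻¹ ∨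
      ∀ u ∈ cent ι, X.trace₁ T (X.phi u) = X.trace₀ T u)
    (hU : IsKanzakiSeparable k (cent ι))
    (hT₀ : ∀ u ∈ cent ι, (∀ u' ∈ cent ι, X.trace₀ T (u * u') = 0) → u = 0)
    (hdepth : X.HasDepthTwo) :
    (∃! W : WeakHopfAlgebra k (centA ι), X.IsDualStructure T W) ∧
    ∀ W : WeakHopfAlgebra k (centA ι), X.IsDualStructure T W →
      (∀ a : centA ι, targetCounit k (centA ι) a = a ↔
        ∃ u ∈ cent ι, leftMul ι u = (a : EndRight ι)) ∧
      ∃ α : WeakHopfAction k (centA ι) M,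
        (∀ (a : centA ι) (m : M), leftMul ι (α.act a m) = adjointAct ι a m) ∧
        (∀ (a : centA ι) (u : M), leftMul ι u = (a : EndRight ι) → α.act a 1 = u) ∧
        ∃ φ : SmashProduct α ≃ₐ[k] EndRight ι,
          ∀ (m : M) (a : centA ι), φ (SmashProduct.mk α m a) = leftMul ι m * (a : EndRight ι) := by
  obtain ⟨D, hw⟩ := StronglySeparableExt.exists_depthTwoData hT hsymm hprod hU hT₀ hdepth
  have hD := D.isDualStructure hw
  refine ⟨⟨D.weakHopf, hD, fun W hW => D.isDualStructure_unique hw hW hD⟩, fun W hW => ?_⟩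
  obtain rfl := D.isDualStructure_unique hw hW hD
  refine ⟨fun a => ?_, D.action, fun a m => (D.adjointAct_eq a m).symm,
    fun a u h => StronglySeparableExt.DepthTwoData.leftMul_one_apply _ a.2 u h, D.smashEquiv, D.smashHom_mk⟩
  -- As ε_t(a) = L_{a(1)}, the fixed points of ε_t are exactly the L_u with u ∈ U.
  rw [D.weakHopf_targetCounit]
  constructor
  · intro h
    exact ⟨_, (StronglySeparableExt.DepthTwoData.atOne a).2, congrArg Subtype.val h⟩
  · rintro ⟨u, hu, h⟩
    have ha : a = lA ⟨u, hu⟩ := Subtype.ext h.symm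
    subst ha
    congr 1
    exact Subtype.ext (mul_one u)
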